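/- **Theorem (Rates of Convergence).** *Setting.* Let $\Omega\subset\mathbb R^d$ be a nonempty bounded open set, let $\mathbf a\in\mathbb R^d\setminus\{0\}$ (constant advection velocity) and $\nu>0$ (constant viscosity). Put $\mathcal V=(H^1_0(\Omega))^d$, $\mathcal Q=L^2_0(\Omega)$, $\mathring{\mathcal V}=\{\mathbf v\in\mathcal V:\nabla\cdot\mathbf v=0\}$, $c(\mathbf a,\mathbf v,\mathbf w)=\int_\Omega(\mathbf a\cdot\nabla\mathbf v)\cdot\mathbf w$, $k(\mathbf v,\mathbf w)=\int_\Omega 2\nu\nabla^s\mathbf v:\nabla^s\mathbf w$, $b(\mathbf v,q)=\int_\Omega(\nabla\cdot\mathbf v)\,q$. Given $\mathbf f\in (L^2(\Omega))^d$, the exact solution $(\mathbf u,p)\in\mathcal V\times\mathcal Q$ of the Oseen problem satisfies $c(\mathbf a,\mathbf u,\mathbf v)+k(\mathbf u,\mathbf v)-b(\mathbf v,p)+b(\mathbf u,q)=(\mathbf f,\mathbf v)$ for all $(\mathbf v,q)\in\mathcal V\times\mathcal Q$. *Discretization.* Let $\mathcal M$ be a mesh of $\Omega$ with finitely many elements $\Omega^e$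 (nonempty, open, pairwise disjoint, with boundaries of measure zero, $\Omega=\mathrm{int}\bigcup_e\overline{\Omega^e}$), let $h_e=\operatorname{diam}\Omega^e$, $h=\max_e h_e$, and suppose that $\mathcal M$ is quasi-uniform: $\max_e h_e\le C_{qu}\min_e h_e$. Let $\mathcal V^h\subset\mathcal V$, $\mathcal Q^h\subset\mathcal Q\cap H^1(\Omega)$ and $\mathcal Q'\subset H^1(\Omega)$ be finite-dimensional spaces with $\mathcal Q^h\subseteq\mathcal Q'$, the functions of $\mathcal V^h$ being in $H^2$ on each element. Put $\tilde{\mathcal Q}=\mathcal Q^h+\mathcal Q'$ and $\mathring{\mathcal V}^h=\{\mathbf v^h\in\mathcal V^h:b(\mathbf v^h,q^h)=0\ \forall q^h\in\mathcal Q^h\}$. Let $\tau_C\ge0$, and let $\tau_M$ be constant on each element. The discrete solution $(\mathbf u^h,\tilde p)\in\mathring{\mathcal V}^h\times\tilde{\mathcal Q}$ satisfies, for all $(\mathbf v^h,\tilde q)\in\mathring{\mathcal V}^h\times\tilde{\mathcal Q}$, $$c(\mathbf a,\mathbf u^h,\mathbf v^h)+k(\mathbf u^h,\mathbf v^h)+(\tau_C\nabla\cdot\mathbf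 u^h,\nabla\cdot\mathbf v^h)+\sum_e\left(\mathbf a\cdot\nabla\mathbf u^h-\nabla\cdot(2\nu\nabla^s\mathbf u^h)+\nabla\tilde p,\ \tau_M(\mathbf a\cdot\nabla\mathbf v^h+\nabla\tilde q)\right)_{\Omega^e}=(\mathbf f,\mathbf v^h)+\sum_e\left(\mathbf f,\tau_M(\mathbf a\cdot\nabla\mathbf v^h+\nabla\tilde q)\right)_{\Omega^e}.$$ *Assumptions.* Let $C_{inv}>0$, $C_{interp}$ be constants, and let $k_v\ge1$, $k_q\ge0$ be integers. 1. $\|\nabla\cdot(2\nu\nabla^s\mathbf v^h)\|^2_{L^2(\Omega^e)}\le C_{inv}h_e^{-2}\|\nu\nabla^s\mathbf v^h\|^2_{L^2(\Omega^e)}$ for every element and every $\mathbf v^h\in\mathcal V^h$. 2. $\tau_M\le h_e^2/(C_{inv}\nu)$ on every element (implied by 5). 3. $\nabla\cdot\mathcal V^h\subseteq\mathcal Q^h$. 4. There are maps $\mathcal I_v:\mathring{\mathcal V}\to\mathring{\mathcal V}^h$ and $\mathcal I_q:\mathcal Q\to\tilde{\mathcal Q}$ such that for all $\mathbf v\in\mathring{\mathcal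 V}\cap(H^{k_v+1}(\Omega))^d$ and $q\in\mathcal Q\cap H^{k_q+1}(\Omega)$: on every element, $\mathbf v-\mathcal I_v\mathbf v\in (H^{k_v+1}(\Omega^e))^d$ and $q-\mathcal I_qq\in H^{k_q+1}(\Omega^e)$; moreover $\sum_e|\mathbf v-\mathcal I_v\mathbf v|^2_{(H^l(\Omega^e))^d}\le C_{interp}h^{2(k_v+1-l)}|\mathbf v|^2_{(H^{k_v+1}(\Omega))^d}$ for $0\le l\le k_v+1$, and $\sum_e|q-\mathcal I_qq|^2_{H^l(\Omega^e)}\le C_{interp}h^{2(k_q+1-l)}|q|^2_{H^{k_q+1}(\Omega)}$ for $0\le l\le k_q+1$. 5. On every element $\tau_M=\frac{h_e}{2|\mathbf a|}f(\gamma_e)$ with $\gamma_e=\frac{|\mathbf a|h_e}{2\nu}$, where $f:(0,\infty)\to(0,\infty)$ is a fixed nondecreasing function with $f(\gamma)\le\min\{1,4\gamma/C_{inv}\}$ for all $\gamma>0$. *Conclusion.* Define $|||(\mathbf v,q)|||^2=k(\mathbf v,\mathbf v)+\sum_e\left(\mathbf a\cdot\nabla\mathbf v+\nabla q,\tau_M(\mathbf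 a\cdot\nabla\mathbf v+\nabla q)\right)_{\Omega^e}$. There is a constant $C_{bound}>0$ that depends only on $d$, $C_{inv}$, $C_{interp}$, $C_{qu}$ and $f$ (hence is independent of $h$, the mesh, the discrete spaces, $\Omega$, $\mathbf a$, $\nu$, $\tau_C$, $k_v$, $k_q$, $\mathbf f$ and the solutions) such that, whenever the exact solution satisfies $(\mathbf u,p)\in(H^{k_v+1}(\Omega))^d\times H^{k_q+1}(\Omega)$, $$|||(\mathbf u-\mathbf u^h,p-\tilde p)|||^2\le C_{bound}\left(\max\{|\mathbf a|h,\nu\}\,h^{2k_v}|\mathbf u|^2_{(H^{k_v+1}(\Omega))^d}+\max\{|\mathbf a|h,\nu\}^{-1}h^{2k_q+2}|p|^2_{H^{k_q+1}(\Omega)}\right).$$ Here $|v|_{H^l(U)}=\|\nabla^lv\|_{L^2(U)}$. -/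

import Mathlib

open MeasureTheory Set
open scoped ContDiff

noncomputable section

namespace Oseen

/-- The Euclidean space of dimension `d`. Vector fields are maps `E d → E d`; only their values
almost everywhere on the open set under consideration matter. -/
abbrev E (d : ℕ) : Type := EuclideanSpace ℝ (Fin d)

/-- The `i`-th standard basis vector. -/
def basisVec {d : ℕ} (i : Fin d) : E d := EuclideanSpace.single i (1 : ℝ)

/-! ### Weak derivatives and Sobolev spaces -/

/-- Smooth real functions with compact support contained in `U`. -/
def IsTestFunction {d : ℕ} (U : Set (E d)) (φ : E d → ℝ) : Prop :=
  ContDiff ℝ ∞ φ ∧ HasCompactSupport φ ∧ tsupport φ ⊆ U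

/-- `g'` is the weak derivative `∂_{i 0} ⋯ ∂_{i (l-1)} g` of order `l` on the open set `U`. -/
def IsWeakDeriv {d l : ℕ} (U : Set (E d)) (i : Fin l → Fin d) (g g' : E d → ℝ) : Prop :=
  LocallyIntegrableOn g U ∧ LocallyIntegrableOn g' U ∧
    ∀ φ : E d → ℝ, IsTestFunction U φ →
      ∫ x in U, g x * iteratedFDeriv ℝ l φ x (fun j => basisVec (i j)) =
        (-1 : ℝ) ^ l * ∫ x in U, g' x * φ x

open Classical in
/-- The weak derivative `∂_{i 0} ⋯ ∂_{i (l-1)} g` on `U` (unique almost everywhere on `U`);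
it is set to zero if it does not exist. -/
def weakDeriv {d l : ℕ} (U : Set (E d)) (i : Fin l → Fin d) (g : E d → ℝ) : E d → ℝ :=
  if h : ∃ g', IsWeakDeriv U i g g' then h.choose else 0

/-- `g ∈ H^l(U)`: `g` and all its weak derivatives of order at most `l` are in `L²(U)`. -/
def MemH {d : ℕ} (U : Set (E d)) (l : ℕ) (g : E d → ℝ) : Prop :=
  MemLp g 2 (volume.restrict U) ∧
    ∀ m ≤ l, ∀ i : Fin m → Fin d, ∃ g', IsWeakDeriv U i g g' ∧ MemLp g' 2 (volume.restrict U)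

/-- The squared seminorm `|g|²_{H^l(U)} = ‖∇^l g‖²_{L²(U)}`: the sum of the squared `L²(U)` norms
of all the entries of the tensor of weak derivatives of order `l`. -/
def semiSq {d : ℕ} (U : Set (E d)) (l : ℕ) (g : E d → ℝ) : ℝ :=
  ∑ i : Fin l → Fin d, ∫ x in U, (weakDeriv U i g x) ^ 2

/-- `v ∈ (H^l(U))^d`. -/
def MemHVec {d : ℕ} (U : Set (E d)) (l : ℕ) (v : E d → E d) : Prop :=
  ∀ i, MemH U l (fun x => v x i)

/-- The squared seminorm `|v|²_{(H^l(U))^d}`. -/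
def semiSqVec {d : ℕ} (U : Set (E d)) (l : ℕ) (v : E d → E d) : ℝ :=
  ∑ i, semiSq U l (fun x => v x i)

/-- `g ∈ H^1_0(U)`, the closure of the test functions in `H^1(U)`. -/
def MemH10 {d : ℕ} (U : Set (E d)) (g : E d → ℝ) : Prop :=
  MemH U 1 g ∧ ∀ ε > (0 : ℝ), ∃ φ, IsTestFunction U φ ∧
    (∫ x in U, (g x - φ x) ^ 2) +
      ∑ i : Fin d, ∫ x in U, (weakDeriv U ![i] g x - fderiv ℝ φ x (basisVec i)) ^ 2 < ε

/-! ### The differential operators -/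

/-- The partial derivative `∂_i q`. -/
def pd {d : ℕ} (U : Set (E d)) (i : Fin d) (q : E d → ℝ) : E d → ℝ := weakDeriv U ![i] q

/-- The divergence `∇ · v`. -/
def divg {d : ℕ} (U : Set (E d)) (v : E d → E d) (x : E d) : ℝ :=
  ∑ i, pd U i (fun y => v y i) x

/-- The entry `(i, j)` of the symmetrized gradient `∇^s v`. -/
def symGrad {d : ℕ} (U : Set (E d)) (v : E d → E d) (i j : Fin d) (x : E d) : ℝ :=
  (pd U j (fun y => v y i) x + pd U i (fun y => v y j) x) / 2

/-- The `i`-th component of `a · ∇ v`. -/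
def adv {d : ℕ} (U : Set (E d)) (a : E d) (v : E d → E d) (i : Fin d) (x : E d) : ℝ :=
  ∑ j, a j * pd U j (fun y => v y i) x

/-- The `i`-th component of `∇ · (2 ν ∇^s v)`. -/
def viscDiv {d : ℕ} (U : Set (E d)) (ν : ℝ) (v : E d → E d) (i : Fin d) (x : E d) : ℝ :=
  ∑ j, pd U j (fun y => 2 * ν * symGrad U v i j y) x

/-! ### The continuous Oseen problem -/

/-- The velocity space `𝒱 = (H^1_0(Ω))^d`. -/
def VSpace {d : ℕ} (Ω : Set (E d)) : Set (E d → E d) :=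
  {v | ∀ i, MemH10 Ω (fun x => v x i)}

/-- The pressure space `𝒬 = L²_0(Ω)`. -/
def QSpace {d : ℕ} (Ω : Set (E d)) : Set (E d → ℝ) :=
  {q | MemLp q 2 (volume.restrict Ω) ∧ ∫ x in Ω, q x = 0}

/-- The divergence-free velocities in `𝒱`. -/
def VDivFree {d : ℕ} (Ω : Set (E d)) : Set (E d → E d) :=
  {v | v ∈ VSpace Ω ∧ ∀ᵐ x ∂(volume.restrict Ω), divg Ω v x = 0}

/-- `c(a, v, w) = ∫_Ω (a · ∇ v) · w`. -/
def formC {d : ℕ} (Ω : Set (E d)) (a : E d) (v w : E d → E d) : ℝ :=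
  ∫ x in Ω, ∑ i, adv Ω a v i x * w x i

/-- `k(v, w) = ∫_Ω 2 ν ∇^s v : ∇^s w`. -/
def formK {d : ℕ} (Ω : Set (E d)) (ν : ℝ) (v w : E d → E d) : ℝ :=
  ∫ x in Ω, ∑ i, ∑ j, 2 * ν * symGrad Ω v i j x * symGrad Ω w i j x

/-- `b(v, q) = ∫_Ω (∇ · v) q`. -/
def formB {d : ℕ} (Ω : Set (E d)) (v : E d → E d) (q : E d → ℝ) : ℝ :=
  ∫ x in Ω, divg Ω v x * q x

/-- The `L²(Ω)` inner product of two vector fields. -/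
def innerL2 {d : ℕ} (Ω : Set (E d)) (v w : E d → E d) : ℝ :=
  ∫ x in Ω, ∑ i, v x i * w x i

/-- `(u, p)` is a weak solution of the Oseen problem with source term `F`. -/
def IsOseenSolution {d : ℕ} (Ω : Set (E d)) (a : E d) (ν : ℝ) (F u : E d → E d)
    (p : E d → ℝ) : Prop :=
  u ∈ VSpace Ω ∧ p ∈ QSpace Ω ∧ ∀ v ∈ VSpace Ω, ∀ q ∈ QSpace Ω,
    formC Ω a u v + formK Ω ν u v - formB Ω v p + formB Ω u q = innerL2 Ω F v

/-! ### The mesh and the discrete spaces -/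

/-- A mesh of `Ω` with `n` elements. -/
structure Mesh {d : ℕ} (Ω : Set (E d)) (n : ℕ) where
  /-- The elements. -/
  elem : Fin n → Set (E d)
  isOpen_elem : ∀ e, IsOpen (elem e)
  nonempty_elem : ∀ e, (elem e).Nonempty
  disjoint_elem : ∀ e e', e ≠ e' → Disjoint (elem e) (elem e')
  /-- The element boundaries have measure zero. -/
  null_frontier : ∀ e, volume (frontier (elem e)) = 0
  domain_eq : Ω = interior (⋃ e, closure (elem e))

/-- The diameter `h_e` of an element. -/
def Mesh.he {d n : ℕ} {Ω : Set (E d)} (M : Mesh Ω n) (e : Fin n) : ℝ := Metric.diam (M.elem e)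

/-- The global mesh size `h = max_e h_e`. -/
def Mesh.h {d n : ℕ} {Ω : Set (E d)} (M : Mesh Ω n) : ℝ := ⨆ e, M.he e

/-- The mesh is quasi-uniform, with constant `C`: `max_e h_e ≤ C min_e h_e`. -/
def Mesh.QuasiUniform {d n : ℕ} {Ω : Set (E d)} (M : Mesh Ω n) (C : ℝ) : Prop :=
  ∀ e e', M.he e ≤ C * M.he e'

/-- The discrete spaces: the coarse-scale velocities `Vh`, the coarse-scale pressures `Qh` and the
fine-scale pressures `Qf`. Coarse-scale velocities are in `H²` inside each element, as are
(mapped) piecewise polynomials or rational functions. -/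
structure DiscreteSpaces {d n : ℕ} {Ω : Set (E d)} (M : Mesh Ω n) where
  /-- The coarse-scale velocity space `𝒱^h`. -/
  Vh : Submodule ℝ (E d → E d)
  /-- The coarse-scale pressure space `𝒬^h`. -/
  Qh : Submodule ℝ (E d → ℝ)
  /-- The fine-scale pressure space `𝒬'`. -/
  Qf : Submodule ℝ (E d → ℝ)
  finite_Vh : FiniteDimensional ℝ Vh
  finite_Qh : FiniteDimensional ℝ Qh
  finite_Qf : FiniteDimensional ℝ Qf
  Vh_subset : ∀ v ∈ Vh, v ∈ VSpace Ω
  Vh_regular : ∀ v ∈ Vh, ∀ e, MemHVec (M.elem e) 2 v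
  Qh_subset : ∀ q ∈ Qh, q ∈ QSpace Ω
  Qf_subset : ∀ q ∈ Qf, MemH Ω 1 q
  Qh_le_Qf : Qh ≤ Qf

section
variable {d n : ℕ} {Ω : Set (E d)} {M : Mesh Ω n}

/-- The discretely divergence-free velocities in `𝒱^h`. -/
def DiscreteSpaces.VhDivFree (S : DiscreteSpaces M) : Set (E d → E d) :=
  {v | v ∈ S.Vh ∧ ∀ q ∈ S.Qh, formB Ω v q = 0}

/-- The space `𝒬^h + 𝒬'` of total pressures. -/
def DiscreteSpaces.Qtot (S : DiscreteSpaces M) : Submodule ℝ (E d → ℝ) := S.Qh ⊔ S.Qf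

/-- The inverse estimate on every element. -/
def DiscreteSpaces.InverseEstimate (S : DiscreteSpaces M) (ν Cinv : ℝ) : Prop :=
  ∀ e, ∀ v ∈ S.Vh,
    ∫ x in M.elem e, ∑ i, (viscDiv (M.elem e) ν v i x) ^ 2 ≤
      Cinv / M.he e ^ 2 * ∫ x in M.elem e, ∑ i, ∑ j, (ν * symGrad (M.elem e) v i j x) ^ 2

/-- Divergence-conformity: `∇ · 𝒱^h ⊆ 𝒬^h`. -/
def DiscreteSpaces.DivConforming (S : DiscreteSpaces M) : Prop :=
  ∀ v ∈ S.Vh, ∃ q ∈ S.Qh, divg Ω v =ᵐ[volume.restrict Ω] q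

/-- Existence of interpolation operators with the approximation orders `kv` and `kq`. -/
def DiscreteSpaces.InterpolationEstimates (S : DiscreteSpaces M) (kv kq : ℕ) (C : ℝ) : Prop :=
  ∃ (Iv : (E d → E d) → (E d → E d)) (Iq : (E d → ℝ) → (E d → ℝ)),
    (∀ v ∈ VDivFree Ω, Iv v ∈ S.VhDivFree) ∧
    (∀ q ∈ QSpace Ω, Iq q ∈ S.Qtot) ∧
    (∀ v ∈ VDivFree Ω, MemHVec Ω (kv + 1) v →
      (∀ e, MemHVec (M.elem e) (kv + 1) (v - Iv v)) ∧
      ∀ l ≤ kv + 1, ∑ e, semiSqVec (M.elem e) l (v - Iv v) ≤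
        C * M.h ^ (2 * (kv + 1 - l)) * semiSqVec Ω (kv + 1) v) ∧
    (∀ q ∈ QSpace Ω, MemH Ω (kq + 1) q →
      (∀ e, MemH (M.elem e) (kq + 1) (q - Iq q)) ∧
      ∀ l ≤ kq + 1, ∑ e, semiSq (M.elem e) l (q - Iq q) ≤
        C * M.h ^ (2 * (kq + 1 - l)) * semiSq Ω (kq + 1) q)

/-! ### The reduced discrete problem -/

/-- The form `A_red((v, q), (w, r))`. The inner products with the elementwise constant
stabilization parameter `τM` are sums over the element interiors. -/
def Ared (M : Mesh Ω n) (a : E d) (ν : ℝ) (τC : E d → ℝ) (τM : Fin n → ℝ)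
    (v : E d → E d) (q : E d → ℝ) (w : E d → E d) (r : E d → ℝ) : ℝ :=
  formC Ω a v w + formK Ω ν v w + (∫ x in Ω, τC x * divg Ω v x * divg Ω w x) +
    ∑ e, ∫ x in M.elem e, ∑ i, (adv Ω a v i x - viscDiv (M.elem e) ν v i x + pd Ω i q x) *
      (τM e * (adv Ω a w i x + pd Ω i r x))

/-- `(uh, pt)` solves the reduced discrete formulation with source term `F`. -/
def IsReducedSolution (S : DiscreteSpaces M) (a : E d) (ν : ℝ) (τC : E d → ℝ) (τM : Fin n → ℝ)
    (F uh : E d → E d) (pt : E d → ℝ) : Prop :=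
  uh ∈ S.VhDivFree ∧ pt ∈ S.Qtot ∧ ∀ w ∈ S.VhDivFree, ∀ r ∈ S.Qtot,
    Ared M a ν τC τM uh pt w r = innerL2 Ω F w +
      ∑ e, ∫ x in M.elem e, ∑ i, F x i * (τM e * (adv Ω a w i x + pd Ω i r x))

/-- The square of the norm `|||(v, q)|||`. -/
def tripleNormSq (M : Mesh Ω n) (a : E d) (ν : ℝ) (τM : Fin n → ℝ)
    (v : E d → E d) (q : E d → ℝ) : ℝ :=
  formK Ω ν v v +
    ∑ e, ∫ x in M.elem e, ∑ i, (adv Ω a v i x + pd Ω i q x) *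
      (τM e * (adv Ω a v i x + pd Ω i q x))

end

/-- The stabilization parameter on each element is `(h_e / (2 |a|)) f(γ_e)` with the element
Péclet number `γ_e = |a| h_e / (2 ν)`. -/
def StabilizationParameter {d n : ℕ} {Ω : Set (E d)} (M : Mesh Ω n) (a : E d) (ν : ℝ)
    (f : ℝ → ℝ) (τM : Fin n → ℝ) : Prop :=
  ∀ e, τM e = M.he e / (2 * ‖a‖) * f (‖a‖ * M.he e / (2 * ν))

end Oseen

end

namespace Oseen

/-! ### Weak derivatives -/

section WeakDeriv

variable {d l : ℕ} {U V : Set (E d)} {i : Fin l → Fin d} {g g' h h' φ : E d → ℝ}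

/-! Take interpolants `v` of `u` and `q` of `p`, put `η = u - v`, `ψ = p - q`, and let `w = v - uh`,
`r = q - pt` be the discrete error. It suffices to bound `|||(w, r)|||` by norms of `η` and `ψ`.

Two facts give a clean error equation. Since `∇ · 𝒱^h ⊆ 𝒬^h`, discretely divergence-free fields are
divergence-free, so `w` sees neither the pressure nor the `τC` term. Since `u` is in `H²` and `p` in
`H¹`, the momentum equation holds almost everywhere (`IsOseenSolution.momentum`), so the
stabilization is consistent. Testing with `(w, r)` and using `c(a, w, w) = 0` yields
`error_identity`: `|||(w, r)|||²` equals a sum of pairings of `w` and `r` with `η` and `ψ`, plus the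
viscous residual of `w` itself. The latter is absorbed through the inverse estimate and `τM ≤ h_e² /
(Cinv ν)`.

The delicate term is `c(a, η, w) = -c(a, w, η)`, because the norm controls neither `a · ∇ w` alone
nor the full gradient of `w` directly. In both regimes the remedy is that `η` is divergence-free,
hence orthogonal to gradients. If `ν ≤ |a| h`, adding `∇ r` turns the term into a pairing of `η`
with `a · ∇ w + ∇ r`, which the stabilization controls at the price of `τM⁻¹ ‖η‖²`; monotonicity of
`f` and quasi-uniformity give `τM⁻¹ ≤ C |a| / h`. If `|a| h ≤ ν`, subtracting the gradient of `a ·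
w` with its sign changed turns `a · ∇ w` into `2 (∇^s w) a`, which `k` controls, and `|a|² h² / ν ≤
ν`. `abs_formC_le_of_interpolation` merges the regimes into a bound by `max (|a| h) ν`.

All remaining terms are handled by Young's inequality with weights that leave a positive part of
`|||(w, r)|||²` on the left. Bounds of `τM` convert them to Sobolev seminorms of `η` and `ψ`, and
the interpolation estimates finish the argument. -/

theorem IsTestFunction.mono (hφ : IsTestFunction V φ) (hVU : V ⊆ U) : IsTestFunction U φ :=
  ⟨hφ.1, hφ.2.1, hφ.2.2.trans hVU⟩

theorem IsTestFunction.zero : IsTestFunction U (0 : E d → ℝ) :=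
  ⟨contDiff_const, HasCompactSupport.zero, by simp [tsupport]⟩

theorem IsTestFunction.continuous_iteratedFDeriv (hφ : IsTestFunction U φ)
    (v : Fin l → E d) : Continuous fun x => iteratedFDeriv ℝ l φ x v := by
  have h : Continuous (iteratedFDeriv ℝ l φ) :=
    hφ.1.continuous_iteratedFDeriv (by exact_mod_cast le_top)
  exact (ContinuousMultilinearMap.apply ℝ (fun _ : Fin l => E d) ℝ v).continuous.comp h

theorem tsupport_iteratedFDeriv_apply_subset (φ : E d → ℝ) (v : Fin l → E d) :
    tsupport (fun x => iteratedFDeriv ℝ l φ x v) ⊆ tsupport φ := by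
  refine closure_minimal (fun x hx => ?_) (isClosed_tsupport φ)
  refine support_iteratedFDeriv_subset (𝕜 := ℝ) l (Function.mem_support.2 fun h0 => hx ?_)
  simp [h0]

theorem integrableOn_mul_of_tsupport (hg : LocallyIntegrableOn g U) (hU : IsOpen U)
    {K : Set (E d)} (hK : IsCompact K) (hKU : K ⊆ U) (hφ : Continuous φ) (hφK : tsupport φ ⊆ K) :
    IntegrableOn (fun x => g x * φ x) U := by
  have h1 : IntegrableOn (fun x => g x * φ x) K :=
    (hg.integrableOn_compact_subset hKU hK).mul_continuousOn hφ.continuousOn hK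
  refine h1.of_forall_sdiff_eq_zero hU.measurableSet fun x hx => ?_
  rw [image_eq_zero_of_notMem_tsupport fun h => hx.2 (hφK h), mul_zero]

theorem IsTestFunction.integrableOn_mul (hφ : IsTestFunction U φ) (hg : LocallyIntegrableOn g U)
    (hU : IsOpen U) : IntegrableOn (fun x => g x * φ x) U :=
  integrableOn_mul_of_tsupport hg hU hφ.2.1 hφ.2.2 hφ.1.continuous subset_rfl

theorem IsTestFunction.integrableOn_mul_iteratedFDeriv (hφ : IsTestFunction U φ)
    (hg : LocallyIntegrableOn g U) (hU : IsOpen U) (v : Fin l → E d) :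
    IntegrableOn (fun x => g x * iteratedFDeriv ℝ l φ x v) U :=
  integrableOn_mul_of_tsupport hg hU hφ.2.1 hφ.2.2 (hφ.continuous_iteratedFDeriv v)
    (tsupport_iteratedFDeriv_apply_subset φ v)

theorem setIntegral_mul_eq_of_tsupport (hU : IsOpen U) (hVU : V ⊆ U) (hφ : tsupport φ ⊆ V) :
    ∫ x in U, g x * φ x = ∫ x in V, g x * φ x :=
  setIntegral_eq_of_subset_of_forall_sdiff_eq_zero hU.measurableSet hVU fun x hx => by
    rw [image_eq_zero_of_notMem_tsupport fun h => hx.2 (hφ h), mul_zero]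

/-- The fundamental lemma of the calculus of variations. It serves both the uniqueness of weak
derivatives and the passage from the weak to the pointwise momentum equation. -/
theorem ae_eq_zero_of_forall_isTestFunction (hU : IsOpen U) (hg : LocallyIntegrableOn g U)
    (h : ∀ φ, IsTestFunction U φ → ∫ x in U, g x * φ x = 0) :
    g =ᵐ[volume.restrict U] 0 := by
  refine (ae_restrict_iff' hU.measurableSet).2 ?_
  refine hU.ae_eq_zero_of_integral_contDiff_smul_eq_zero hg fun φ h1 h2 h3 => ?_
  rw [← h φ ⟨h1, h2, h3⟩, ← setIntegral_univ,
    ← setIntegral_mul_eq_of_tsupport isOpen_univ (subset_univ U) h3]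
  simp only [smul_eq_mul, mul_comm]

theorem IsWeakDeriv.ae_eq (hU : IsOpen U) (h1 : IsWeakDeriv U i g g')
    (h2 : IsWeakDeriv U i g h') : g' =ᵐ[volume.restrict U] h' := by
  have key : (fun x => g' x - h' x) =ᵐ[volume.restrict U] 0 := by
    refine ae_eq_zero_of_forall_isTestFunction hU (h1.2.1.sub h2.2.1) fun φ hφ => ?_
    simp only [sub_mul]
    rw [integral_sub (hφ.integrableOn_mul h1.2.1 hU) (hφ.integrableOn_mul h2.2.1 hU), sub_eq_zero]
    have := (h1.2.2 φ hφ).symm.trans (h2.2.2 φ hφ)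
    exact mul_left_cancel₀ (pow_ne_zero _ (by norm_num)) this
  filter_upwards [key] with x hx
  exact sub_eq_zero.1 hx

theorem IsWeakDeriv.weakDeriv (h : IsWeakDeriv U i g g') :
    IsWeakDeriv U i g (weakDeriv U i g) := by
  have h' : ∃ g', IsWeakDeriv U i g g' := ⟨g', h⟩
  unfold Oseen.weakDeriv
  rw [dif_pos h']
  exact h'.choose_spec

/-- Since `weakDeriv` is an arbitrary choice, calculus rules are proved for the relation
`IsWeakDeriv` and transferred by this lemma; they hold only almost everywhere. -/
theorem IsWeakDeriv.weakDeriv_ae_eq (hU : IsOpen U) (h : IsWeakDeriv U i g g') :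
    Oseen.weakDeriv U i g =ᵐ[volume.restrict U] g' :=
  h.weakDeriv.ae_eq hU h

theorem IsWeakDeriv.congr_left (h : IsWeakDeriv U i g g')
    (hgh : g =ᵐ[volume.restrict U] h') (hh : LocallyIntegrableOn h' U) : IsWeakDeriv U i h' g' := by
  refine ⟨hh, h.2.1, fun φ hφ => Eq.trans ?_ (h.2.2 φ hφ)⟩
  refine integral_congr_ae ?_
  filter_upwards [hgh] with x hx
  rw [hx]

/-- Test functions on the smaller set are test functions on the larger one. This identifies
derivatives taken on an element with those taken on the whole domain. -/
theorem IsWeakDeriv.mono (hU : IsOpen U) (hVU : V ⊆ U) (h : IsWeakDeriv U i g g') :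
    IsWeakDeriv V i g g' := by
  refine ⟨h.1.mono_set hVU, h.2.1.mono_set hVU, fun φ hφ => ?_⟩
  rw [← setIntegral_mul_eq_of_tsupport hU hVU hφ.2.2, ← h.2.2 φ (hφ.mono hVU)]
  exact (setIntegral_mul_eq_of_tsupport hU hVU
    ((tsupport_iteratedFDeriv_apply_subset φ _).trans hφ.2.2)).symm

theorem IsWeakDeriv.add (hU : IsOpen U) (h1 : IsWeakDeriv U i g g')
    (h2 : IsWeakDeriv U i h h') : IsWeakDeriv U i (g + h) (g' + h') := by
  refine ⟨h1.1.add h2.1, h1.2.1.add h2.2.1, fun φ hφ => ?_⟩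
  simp only [Pi.add_apply, add_mul]
  rw [integral_add (hφ.integrableOn_mul_iteratedFDeriv h1.1 hU _)
    (hφ.integrableOn_mul_iteratedFDeriv h2.1 hU _),
    integral_add (hφ.integrableOn_mul h1.2.1 hU) (hφ.integrableOn_mul h2.2.1 hU),
    h1.2.2 φ hφ, h2.2.2 φ hφ, mul_add]

theorem IsWeakDeriv.const_mul (c : ℝ) (h : IsWeakDeriv U i g g') :
    IsWeakDeriv U i (fun x => c * g x) (fun x => c * g' x) := by
  refine ⟨h.1.smul c, h.2.1.smul c, fun φ hφ => ?_⟩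
  simp only [mul_assoc]
  rw [integral_const_mul, integral_const_mul, h.2.2 φ hφ]
  ring

theorem IsWeakDeriv.sub (hU : IsOpen U) (h1 : IsWeakDeriv U i g g')
    (h2 : IsWeakDeriv U i h h') : IsWeakDeriv U i (g - h) (g' - h') := by
  have := h1.add hU (h2.const_mul (-1))
  convert this using 1 <;> (ext x; simp [sub_eq_add_neg])

theorem isWeakDeriv_zero_order (i : Fin 0 → Fin d) (hg : LocallyIntegrableOn g U) :
    IsWeakDeriv U i g g :=
  ⟨hg, hg, fun φ _ => by simp⟩

theorem isWeakDeriv_one_iff {j : Fin d} : IsWeakDeriv U ![j] g g' ↔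
    LocallyIntegrableOn g U ∧ LocallyIntegrableOn g' U ∧ ∀ φ, IsTestFunction U φ →
      ∫ x in U, g x * fderiv ℝ φ x (basisVec j) = - ∫ x in U, g' x * φ x := by
  simp [IsWeakDeriv]

theorem isWeakDeriv_zero : IsWeakDeriv U i (0 : E d → ℝ) 0 :=
  ⟨locallyIntegrableOn_zero, locallyIntegrableOn_zero, fun φ _ => by simp⟩

theorem IsTestFunction.fderiv_apply (hφ : IsTestFunction U φ) (v : E d) :
    IsTestFunction U (fun x => fderiv ℝ φ x v) := by
  have hs : tsupport (fun x => fderiv ℝ φ x v) ⊆ tsupport φ :=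
    closure_minimal (fun x hx => support_fderiv_subset ℝ
      (Function.mem_support.2 fun h0 => hx (by simp [h0]))) (isClosed_tsupport φ)
  refine ⟨?_, hφ.2.1.of_isClosed_subset (isClosed_tsupport _) hs, hs.trans hφ.2.2⟩
  exact (hφ.1.fderiv_right (m := ∞) (by simp)).clm_apply contDiff_const

theorem isWeakDeriv_two_iff {j k : Fin d} : IsWeakDeriv U ![j, k] g g' ↔
    LocallyIntegrableOn g U ∧ LocallyIntegrableOn g' U ∧ ∀ φ, IsTestFunction U φ →
      ∫ x in U, g x * fderiv ℝ (fun y => fderiv ℝ φ y (basisVec k)) x (basisVec j) =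
        ∫ x in U, g' x * φ x := by
  have key : ∀ φ, IsTestFunction U φ → ∀ x,
      iteratedFDeriv ℝ 2 φ x (fun m => basisVec (![j, k] m)) =
        fderiv ℝ (fun y => fderiv ℝ φ y (basisVec k)) x (basisVec j) := by
    intro φ hφ x
    have hd : DifferentiableAt ℝ (fderiv ℝ φ) x :=
      ((hφ.1.fderiv_right (m := ∞) (by simp)).differentiable (by simp)) x
    rw [iteratedFDeriv_two_apply, fderiv_clm_apply hd (differentiableAt_const _)]
    simp
  refine and_congr_right fun _ => and_congr_right fun _ =>
    forall_congr' fun φ => forall_congr' fun hφ => ?_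
  simp [key φ hφ]

/-- A second-order weak derivative is a weak derivative of a first-order one. -/
theorem IsWeakDeriv.of_two {j k : Fin d} (h1 : IsWeakDeriv U ![j] g g')
    (h2 : IsWeakDeriv U ![j, k] g h') : IsWeakDeriv U ![k] g' h' := by
  refine isWeakDeriv_one_iff.2 ⟨h1.2.1, h2.2.1, fun φ hφ => ?_⟩
  rw [← (isWeakDeriv_two_iff.1 h2).2.2 φ hφ,
    (isWeakDeriv_one_iff.1 h1).2.2 _ (hφ.fderiv_apply (basisVec k)), neg_neg]

end WeakDeriv

/-! ### Sobolev functions -/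

section Sobolev

variable {d l m : ℕ} {U V : Set (E d)} {i j : Fin d} {g h φ : E d → ℝ}

theorem locallyIntegrableOn_of_memLp (hg : MemLp g 2 (volume.restrict U)) :
    LocallyIntegrableOn g U :=
  locallyIntegrableOn_of_locallyIntegrable_restrict (hg.locallyIntegrable (by norm_num))

theorem _root_.MeasureTheory.MemLp.restrict_mono (hg : MemLp g 2 (volume.restrict U))
    (hVU : V ⊆ U) : MemLp g 2 (volume.restrict V) :=
  hg.mono_measure (Measure.restrict_mono_set _ hVU)

theorem MemH.isWeakDeriv (hg : MemH U l g) (hm : m ≤ l) (k : Fin m → Fin d) :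
    IsWeakDeriv U k g (weakDeriv U k g) := by
  obtain ⟨g', h1, -⟩ := hg.2 m hm k
  exact h1.weakDeriv

theorem MemH.memLp_weakDeriv (hU : IsOpen U) (hg : MemH U l g) (hm : m ≤ l) (k : Fin m → Fin d) :
    MemLp (weakDeriv U k g) 2 (volume.restrict U) := by
  obtain ⟨g', h1, h2⟩ := hg.2 m hm k
  exact (memLp_congr_ae (h1.weakDeriv_ae_eq hU)).2 h2

theorem MemH.of_le (hg : MemH U l g) (hm : m ≤ l) : MemH U m g :=
  ⟨hg.1, fun k hk => hg.2 k (hk.trans hm)⟩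

theorem MemH.mono (hU : IsOpen U) (hVU : V ⊆ U) (hg : MemH U l g) : MemH V l g :=
  ⟨hg.1.restrict_mono hVU, fun k hk i => by
    obtain ⟨g', h1, h2⟩ := hg.2 k hk i
    exact ⟨g', h1.mono hU hVU, h2.restrict_mono hVU⟩⟩

theorem MemH.add (hU : IsOpen U) (hg : MemH U l g) (hh : MemH U l h) : MemH U l (g + h) :=
  ⟨hg.1.add hh.1, fun k hk i => by
    obtain ⟨g', h1, h2⟩ := hg.2 k hk i
    obtain ⟨g'', h3, h4⟩ := hh.2 k hk i
    exact ⟨g' + g'', h1.add hU h3, h2.add h4⟩⟩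

theorem MemH.const_mul (c : ℝ) (hg : MemH U l g) : MemH U l (fun x => c * g x) :=
  ⟨hg.1.const_mul c, fun k hk i => by
    obtain ⟨g', h1, h2⟩ := hg.2 k hk i
    exact ⟨_, h1.const_mul c, h2.const_mul c⟩⟩

theorem MemH.sub (hU : IsOpen U) (hg : MemH U l g) (hh : MemH U l h) : MemH U l (g - h) := by
  convert hg.add hU (hh.const_mul (-1)) using 1
  ext x
  simp [sub_eq_add_neg]

theorem MemH.pd_isWeakDeriv (hg : MemH U 1 g) (i : Fin d) : IsWeakDeriv U ![i] g (pd U i g) :=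
  hg.isWeakDeriv le_rfl _

theorem MemH.pd_memLp (hU : IsOpen U) (hg : MemH U 1 g) (i : Fin d) :
    MemLp (pd U i g) 2 (volume.restrict U) :=
  hg.memLp_weakDeriv hU le_rfl _

theorem pd_sub (hU : IsOpen U) (hg : MemH U 1 g) (hh : MemH U 1 h) (i : Fin d) :
    pd U i (g - h) =ᵐ[volume.restrict U] pd U i g - pd U i h :=
  ((hg.pd_isWeakDeriv i).sub hU (hh.pd_isWeakDeriv i)).weakDeriv_ae_eq hU

theorem pd_add (hU : IsOpen U) (hg : MemH U 1 g) (hh : MemH U 1 h) (i : Fin d) :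
    pd U i (g + h) =ᵐ[volume.restrict U] pd U i g + pd U i h :=
  ((hg.pd_isWeakDeriv i).add hU (hh.pd_isWeakDeriv i)).weakDeriv_ae_eq hU

theorem pd_const_mul (hU : IsOpen U) (c : ℝ) (hg : MemH U 1 g) (i : Fin d) :
    pd U i (fun x => c * g x) =ᵐ[volume.restrict U] fun x => c * pd U i g x :=
  ((hg.pd_isWeakDeriv i).const_mul c).weakDeriv_ae_eq hU

theorem pd_zero (hU : IsOpen U) (i : Fin d) :
    pd U i (0 : E d → ℝ) =ᵐ[volume.restrict U] 0 :=
  isWeakDeriv_zero.weakDeriv_ae_eq hU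

theorem pd_restrict (hU : IsOpen U) (hV : IsOpen V) (hVU : V ⊆ U) (hg : MemH U 1 g) (i : Fin d) :
    pd V i g =ᵐ[volume.restrict V] pd U i g :=
  ((hg.pd_isWeakDeriv i).mono hU hVU).weakDeriv_ae_eq hV

/-- The definition of `MemH` also asks for a derivative of order zero, which is the function itself.
-/
theorem memH_one_of_forall (hg : MemLp g 2 (volume.restrict U))
    (h : ∀ i, ∃ g', IsWeakDeriv U ![i] g g' ∧ MemLp g' 2 (volume.restrict U)) : MemH U 1 g := by
  refine ⟨hg, fun k hk => ?_⟩
  interval_cases k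
  · exact fun s => ⟨g, isWeakDeriv_zero_order s (locallyIntegrableOn_of_memLp hg), hg⟩
  · intro s
    have hs : s = ![s 0] := by ext k; simp [Subsingleton.elim k 0]
    rw [hs]
    exact h (s 0)

/-- The first weak derivatives of an `H²` function are in `H¹`. -/
theorem MemH.pd_memH (hU : IsOpen U) (hg : MemH U 2 g) (i : Fin d) : MemH U 1 (pd U i g) := by
  have h1 : MemH U 1 g := hg.of_le one_le_two
  exact memH_one_of_forall (h1.pd_memLp hU i) fun j =>
    ⟨_, (h1.pd_isWeakDeriv i).of_two (hg.isWeakDeriv le_rfl ![i, j]),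
      hg.memLp_weakDeriv hU le_rfl _⟩

theorem MemH.pd_pd (hU : IsOpen U) (hg : MemH U 2 g) (i j : Fin d) :
    pd U j (pd U i g) =ᵐ[volume.restrict U] weakDeriv U ![i, j] g :=
  (((hg.of_le one_le_two).pd_isWeakDeriv i).of_two
    (hg.isWeakDeriv le_rfl ![i, j])).weakDeriv_ae_eq hU

theorem semiSq_zero_order (hU : IsOpen U) (hg : MemLp g 2 (volume.restrict U)) :
    semiSq U 0 g = ∫ x in U, g x ^ 2 := by
  unfold semiSq
  rw [Fintype.sum_unique]
  refine integral_congr_ae ?_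
  filter_upwards [(isWeakDeriv_zero_order default
    (locallyIntegrableOn_of_memLp hg)).weakDeriv_ae_eq hU] with x hx
  rw [hx]

theorem semiSq_one (U : Set (E d)) (g : E d → ℝ) :
    semiSq U 1 g = ∑ i, ∫ x in U, pd U i g x ^ 2 := by
  unfold semiSq pd
  refine Fintype.sum_equiv (Equiv.funUnique (Fin 1) (Fin d)) _ _ fun s => ?_
  have : s = ![s 0] := by ext k; simp [Subsingleton.elim k 0]
  simp [← this]

theorem semiSq_two (U : Set (E d)) (g : E d → ℝ) :
    semiSq U 2 g = ∑ i, ∑ j, ∫ x in U, weakDeriv U ![i, j] g x ^ 2 := by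
  unfold semiSq
  rw [← Fintype.sum_prod_type' (f := fun i j => ∫ x in U, weakDeriv U ![i, j] g x ^ 2)]
  refine Fintype.sum_equiv (finTwoArrowEquiv (Fin d)) _ _ fun s => ?_
  have : s = ![s 0, s 1] := by ext k; fin_cases k <;> rfl
  simp [← this]

theorem semiSq_nonneg (U : Set (E d)) (l : ℕ) (g : E d → ℝ) : 0 ≤ semiSq U l g :=
  Finset.sum_nonneg fun _ _ => integral_nonneg fun _ => sq_nonneg _

/-! ### Integration by parts -/

theorem IsTestFunction.memLp (hφ : IsTestFunction U φ) : MemLp φ 2 (volume.restrict U) :=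
  (hφ.1.continuous.memLp_of_hasCompactSupport hφ.2.1).restrict U

theorem IsTestFunction.isWeakDeriv (hφ : IsTestFunction U φ) (i : Fin d) :
    IsWeakDeriv U ![i] φ (fun x => fderiv ℝ φ x (basisVec i)) := by
  have hφ' := hφ.fderiv_apply (basisVec i)
  refine isWeakDeriv_one_iff.2 ⟨locallyIntegrableOn_of_memLp hφ.memLp,
    locallyIntegrableOn_of_memLp hφ'.memLp, fun ψ hψ => ?_⟩
  have hψ' := hψ.fderiv_apply (basisVec i)
  rw [setIntegral_eq_integral_of_forall_compl_eq_zero,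
    setIntegral_eq_integral_of_forall_compl_eq_zero]
  · have hloc : ∀ {χ : E d → ℝ}, IsTestFunction U χ → LocallyIntegrableOn χ univ := fun h =>
      h.1.continuous.locallyIntegrable.locallyIntegrableOn _
    have hint : ∀ {χ θ : E d → ℝ}, IsTestFunction U χ → IsTestFunction U θ →
        Integrable (fun x => χ x * θ x) := fun h1 h2 => by
      have := (h2.mono (subset_univ U)).integrableOn_mul (hloc h1) isOpen_univ
      rwa [integrableOn_univ] at this
    exact integral_mul_fderiv_eq_neg_fderiv_mul_of_integrable (hint hφ' hψ) (hint hφ hψ')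
      (hint hφ hψ) (fun x _ => hφ.1.differentiable (by simp) x)
      (fun x _ => hψ.1.differentiable (by simp) x)
  · intro x hx
    rw [image_eq_zero_of_notMem_tsupport fun h => hx (hψ.2.2 h), mul_zero]
  · intro x hx
    rw [image_eq_zero_of_notMem_tsupport fun h => hx (hφ.2.2 h), zero_mul]

theorem IsTestFunction.pd_ae_eq (hφ : IsTestFunction U φ) (hU : IsOpen U) (i : Fin d) :
    pd U i φ =ᵐ[volume.restrict U] fun x => fderiv ℝ φ x (basisVec i) :=
  (hφ.isWeakDeriv i).weakDeriv_ae_eq hU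

theorem IsTestFunction.memH_one (hφ : IsTestFunction U φ) : MemH U 1 φ :=
  memH_one_of_forall hφ.memLp fun i => ⟨_, hφ.isWeakDeriv i, (hφ.fderiv_apply _).memLp⟩

theorem IsTestFunction.memH10 (hφ : IsTestFunction U φ) (hU : IsOpen U) : MemH10 U φ := by
  refine ⟨hφ.memH_one, fun ε hε => ⟨φ, hφ, ?_⟩⟩
  have : ∀ i : Fin d, ∫ x in U, (weakDeriv U ![i] φ x - fderiv ℝ φ x (basisVec i)) ^ 2 = 0 := by
    intro i
    rw [← integral_zero (E d) ℝ (μ := volume.restrict U)]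
    refine integral_congr_ae ?_
    filter_upwards [hφ.pd_ae_eq hU i] with x hx
    rw [pd] at hx
    simp [hx]
  simpa [this] using hε

theorem integrable_mul_of_memLp {X : Type*} [MeasurableSpace X] {μ : Measure X} {g h : X → ℝ}
    (hg : MemLp g 2 μ) (hh : MemLp h 2 μ) : Integrable (fun x => g x * h x) μ :=
  hg.integrable_mul hh

theorem abs_integral_mul_le {X : Type*} [MeasurableSpace X] {μ : Measure X} {g h : X → ℝ}
    (hg : MemLp g 2 μ) (hh : MemLp h 2 μ) :
    |∫ x, g x * h x ∂μ| ≤ √(∫ x, g x ^ 2 ∂μ) * √(∫ x, h x ^ 2 ∂μ) := by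
  have h1 := integral_mul_norm_le_Lp_mul_Lq (E := ℝ) (μ := μ) (f := g) (g := h)
    Real.HolderConjugate.two_two (by simpa using hg) (by simpa using hh)
  have h2 : |∫ x, g x * h x ∂μ| ≤ ∫ x, ‖g x‖ * ‖h x‖ ∂μ := by
    simpa using norm_integral_le_integral_norm (μ := μ) fun x => g x * h x
  refine (h2.trans h1).trans (le_of_eq ?_)
  simp [Real.sqrt_eq_rpow]

/-- Integration by parts: `∫ ∂_i g r = - ∫ g ∂_i r` for `g ∈ H^1_0` and `r ∈ H^1`. -/
theorem MemH10.integral_pd_mul (hU : IsOpen U) (hg : MemH10 U g) (hh : MemH U 1 h) (i : Fin d) :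
    ∫ x in U, pd U i g x * h x = - ∫ x in U, g x * pd U i h x := by
  have hg1 := hg.1.1
  have hg2 := hg.1.pd_memLp hU i
  have hh1 := hh.1
  have hh2 := hh.pd_memLp hU i
  rw [← sub_eq_zero, sub_neg_eq_add]
  set D := (∫ x in U, pd U i g x * h x) + ∫ x in U, g x * pd U i h x with hD
  set N := √(∫ x in U, h x ^ 2) + √(∫ x in U, pd U i h x ^ 2)
  -- The defect `D` vanishes for test functions, by the definition of the weak derivative of `h`.
  -- Replacing `g` by an approximating test function changes it by at most `δ * N`, by
  -- Cauchy–Schwarz.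
  have key : ∀ δ > 0, |D| ≤ δ * N := by
    intro δ hδ
    obtain ⟨φ, hφ, hlt⟩ := hg.2 (δ ^ 2) (by positivity)
    have hφ' := hφ.fderiv_apply (basisVec i)
    have hs : 0 ≤ ∑ k : Fin d, ∫ x in U, (weakDeriv U ![k] g x - fderiv ℝ φ x (basisVec k)) ^ 2 :=
      Finset.sum_nonneg fun _ _ => integral_nonneg fun _ => sq_nonneg _
    have h0 : 0 ≤ ∫ x in U, (g x - φ x) ^ 2 := integral_nonneg fun _ => sq_nonneg _
    have hb1 : ∫ x in U, (g x - φ x) ^ 2 ≤ δ ^ 2 := by linarith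
    have hb2 : ∫ x in U, (pd U i g x - fderiv ℝ φ x (basisVec i)) ^ 2 ≤ δ ^ 2 := by
      have := Finset.single_le_sum
        (f := fun k => ∫ x in U, (weakDeriv U ![k] g x - fderiv ℝ φ x (basisVec k)) ^ 2)
        (fun _ _ => integral_nonneg fun _ => sq_nonneg _) (Finset.mem_univ i)
      simp only [pd]
      linarith
    have hDe : D = (∫ x in U, (pd U i g x - fderiv ℝ φ x (basisVec i)) * h x) +
        ∫ x in U, (g x - φ x) * pd U i h x := by
      simp only [sub_mul]
      rw [integral_sub (integrable_mul_of_memLp hg2 hh1) (integrable_mul_of_memLp hφ'.memLp hh1),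
        integral_sub (integrable_mul_of_memLp hg1 hh2) (integrable_mul_of_memLp hφ.memLp hh2)]
      have := (isWeakDeriv_one_iff.1 (hh.pd_isWeakDeriv i)).2.2 φ hφ
      simp only [mul_comm (h _), mul_comm (pd U i h _)] at this
      rw [hD, this]
      ring
    have e1 := abs_integral_mul_le (hg2.sub hφ'.memLp) hh1
    have e2 := abs_integral_mul_le (hg1.sub hφ.memLp) hh2
    simp only [Pi.sub_apply] at e1 e2
    have s1 : √(∫ x in U, (pd U i g x - fderiv ℝ φ x (basisVec i)) ^ 2) ≤ δ :=
      Real.sqrt_le_iff.2 ⟨hδ.le, hb2⟩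
    have s2 : √(∫ x in U, (g x - φ x) ^ 2) ≤ δ := Real.sqrt_le_iff.2 ⟨hδ.le, hb1⟩
    rw [hDe]
    refine (abs_add_le _ _).trans ?_
    rw [mul_add]
    exact add_le_add (e1.trans (mul_le_mul_of_nonneg_right s1 (Real.sqrt_nonneg _)))
      (e2.trans (mul_le_mul_of_nonneg_right s2 (Real.sqrt_nonneg _)))
  have hN : 0 ≤ N := by positivity
  by_contra hne
  have hpos : 0 < |D| := abs_pos.2 hne
  -- For this `δ` the bound reads `|D| ≤ |D| * N / (2 * (N + 1))`, impossible when `|D| > 0`; the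
  -- summand `1` covers `N = 0`.
  have := key (|D| / (2 * (N + 1))) (by positivity)
  rw [div_mul_eq_mul_div, le_div_iff₀ (by positivity)] at this
  nlinarith

/-- Integrate by parts against the constant `1`, which lies in `H^1` because the set is bounded. -/
theorem MemH10.integral_pd_eq_zero (hU : IsOpen U) (hbd : Bornology.IsBounded U)
    (hg : MemH10 U g) (i : Fin d) : ∫ x in U, pd U i g x = 0 := by
  have : IsFiniteMeasure (volume.restrict U) := ⟨by
    rw [Measure.restrict_apply_univ]; exact hbd.measure_lt_top⟩
  have hone : MemLp (fun _ : E d => (1 : ℝ)) 2 (volume.restrict U) := memLp_const 1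
  have hw : ∀ j : Fin d, IsWeakDeriv U ![j] (fun _ => (1 : ℝ)) 0 := fun j => by
    refine isWeakDeriv_one_iff.2 ⟨locallyIntegrableOn_of_memLp hone, locallyIntegrableOn_zero,
      fun φ hφ => ?_⟩
    have hφ' := hφ.fderiv_apply (basisVec j)
    have hc : ∀ {χ : E d → ℝ}, IsTestFunction U χ → Integrable χ := fun h =>
      h.1.continuous.integrable_of_hasCompactSupport h.2.1
    rw [setIntegral_eq_integral_of_forall_compl_eq_zero fun x hx => by
      rw [image_eq_zero_of_notMem_tsupport fun h => hx (hφ'.2.2 h), mul_zero]]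
    have := integral_mul_fderiv_eq_neg_fderiv_mul_of_integrable (μ := (volume : Measure (E d)))
      (f := fun _ => (1 : ℝ)) (g := φ) (v := basisVec j) (by simp) (by simpa using hc hφ')
      (by simpa using hc hφ) (fun x _ => differentiableAt_const _)
      (fun x _ => hφ.1.differentiable (by simp) x)
    simpa using this
  have hH : MemH U 1 (fun _ : E d => (1 : ℝ)) :=
    memH_one_of_forall hone fun j => ⟨_, hw j, MemLp.zero⟩
  have := hg.integral_pd_mul hU hH i
  simp only [mul_one] at this
  rw [this, neg_eq_zero, ← integral_zero (E d) ℝ (μ := volume.restrict U)]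
  refine integral_congr_ae ?_
  filter_upwards [(hw i).weakDeriv_ae_eq hU] with x hx
  rw [pd, hx]
  simp

end Sobolev

/-! ### Differential operators on vector fields -/

section Operators

variable {d l : ℕ} {U V : Set (E d)} {a : E d} {ν : ℝ} {v w : E d → E d} {q r : E d → ℝ}
  {i j : Fin d}

theorem MemHVec.of_le {m : ℕ} (hv : MemHVec U l v) (hm : m ≤ l) : MemHVec U m v :=
  fun i => (hv i).of_le hm

theorem MemHVec.mono (hU : IsOpen U) (hVU : V ⊆ U) (hv : MemHVec U l v) : MemHVec V l v :=
  fun i => (hv i).mono hU hVU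

theorem MemHVec.sub (hU : IsOpen U) (hv : MemHVec U l v) (hw : MemHVec U l w) :
    MemHVec U l (v - w) :=
  fun i => (hv i).sub hU (hw i)

theorem pd_comp_sub (hU : IsOpen U) (hv : MemHVec U 1 v) (hw : MemHVec U 1 w) (i j : Fin d) :
    pd U j (fun y => (v - w) y i) =ᵐ[volume.restrict U]
      pd U j (fun y => v y i) - pd U j (fun y => w y i) :=
  pd_sub hU (hv i) (hw i) j

theorem ae_forall_pd_comp_sub (hU : IsOpen U) (hv : MemHVec U 1 v) (hw : MemHVec U 1 w) :
    ∀ᵐ x ∂volume.restrict U, ∀ i j, pd U j (fun y => (v - w) y i) x =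
      pd U j (fun y => v y i) x - pd U j (fun y => w y i) x :=
  ae_all_iff.2 fun i => ae_all_iff.2 fun j => pd_comp_sub hU hv hw i j

theorem ae_forall_pd_comp_restrict (hU : IsOpen U) (hV : IsOpen V) (hVU : V ⊆ U)
    (hv : MemHVec U 1 v) : ∀ᵐ x ∂volume.restrict V, ∀ i j,
      pd V j (fun y => v y i) x = pd U j (fun y => v y i) x :=
  ae_all_iff.2 fun i => ae_all_iff.2 fun j => pd_restrict hU hV hVU (hv i) j

theorem divg_sub (hU : IsOpen U) (hv : MemHVec U 1 v) (hw : MemHVec U 1 w) :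
    ∀ᵐ x ∂volume.restrict U, divg U (v - w) x = divg U v x - divg U w x := by
  filter_upwards [ae_forall_pd_comp_sub hU hv hw] with x hx
  simp only [divg, hx, Finset.sum_sub_distrib]

theorem symGrad_sub (hU : IsOpen U) (hv : MemHVec U 1 v) (hw : MemHVec U 1 w) :
    ∀ᵐ x ∂volume.restrict U, ∀ i j,
      symGrad U (v - w) i j x = symGrad U v i j x - symGrad U w i j x := by
  filter_upwards [ae_forall_pd_comp_sub hU hv hw] with x hx i j
  simp only [symGrad, hx]
  ring

theorem adv_sub (hU : IsOpen U) (hv : MemHVec U 1 v) (hw : MemHVec U 1 w) (a : E d) :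
    ∀ᵐ x ∂volume.restrict U, ∀ i, adv U a (v - w) i x = adv U a v i x - adv U a w i x := by
  filter_upwards [ae_forall_pd_comp_sub hU hv hw] with x hx i
  simp only [adv, hx, mul_sub, Finset.sum_sub_distrib]

theorem ae_forall_pd_sub (hU : IsOpen U) (hq : MemH U 1 q) (hr : MemH U 1 r) :
    ∀ᵐ x ∂volume.restrict U, ∀ i, pd U i (q - r) x = pd U i q x - pd U i r x :=
  ae_all_iff.2 fun i => pd_sub hU hq hr i

theorem symGrad_restrict (hU : IsOpen U) (hV : IsOpen V) (hVU : V ⊆ U) (hv : MemHVec U 1 v) :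
    ∀ᵐ x ∂volume.restrict V, ∀ i j, symGrad V v i j x = symGrad U v i j x := by
  filter_upwards [ae_forall_pd_comp_restrict hU hV hVU hv] with x hx i j
  simp only [symGrad, hx]

theorem memLp_divg (hU : IsOpen U) (hv : MemHVec U 1 v) :
    MemLp (divg U v) 2 (volume.restrict U) :=
  memLp_finsetSum _ fun i _ => (hv i).pd_memLp hU i

theorem memLp_symGrad (hU : IsOpen U) (hv : MemHVec U 1 v) (i j : Fin d) :
    MemLp (symGrad U v i j) 2 (volume.restrict U) := by
  have := (((hv i).pd_memLp hU j).add ((hv j).pd_memLp hU i)).const_mul (1 / 2)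
  convert this using 1
  ext x
  simp only [symGrad, Pi.add_apply]
  ring

theorem memLp_adv (hU : IsOpen U) (hv : MemHVec U 1 v) (a : E d) (i : Fin d) :
    MemLp (adv U a v i) 2 (volume.restrict U) :=
  memLp_finsetSum _ fun j _ => ((hv i).pd_memLp hU j).const_mul (a j)

theorem memH_symGrad (hU : IsOpen U) (hv : MemHVec U 2 v) (ν : ℝ) (i j : Fin d) :
    MemH U 1 (fun y => 2 * ν * symGrad U v i j y) := by
  have := (((hv i).pd_memH hU j).add hU ((hv j).pd_memH hU i)).const_mul ν
  convert this using 1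
  ext x
  simp only [symGrad, Pi.add_apply]
  ring

theorem memLp_viscDiv (hU : IsOpen U) (hv : MemHVec U 2 v) (ν : ℝ) (i : Fin d) :
    MemLp (viscDiv U ν v i) 2 (volume.restrict U) :=
  memLp_finsetSum _ fun j _ => (memH_symGrad hU hv ν i j).pd_memLp hU j

/-- Expressing the viscous term through second weak derivatives makes it comparable with the `H²`
seminorm. -/
theorem viscDiv_ae_eq (hU : IsOpen U) (hv : MemHVec U 2 v) (ν : ℝ) :
    ∀ᵐ x ∂volume.restrict U, ∀ i, viscDiv U ν v i x =
      ν * ∑ j, (weakDeriv U ![j, j] (fun y => v y i) x +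
        weakDeriv U ![i, j] (fun y => v y j) x) := by
  have key : ∀ i j, ∀ᵐ x ∂volume.restrict U, pd U j (fun y => 2 * ν * symGrad U v i j y) x =
      ν * (weakDeriv U ![j, j] (fun y => v y i) x + weakDeriv U ![i, j] (fun y => v y j) x) := by
    intro i j
    have e : (fun y => 2 * ν * symGrad U v i j y) =
        fun y => ν * (pd U j (fun y => v y i) + pd U i (fun y => v y j)) y := by
      ext x
      simp only [symGrad, Pi.add_apply]
      ring
    rw [e]
    have h1 := (hv i).pd_memH hU j
    have h2 := (hv j).pd_memH hU i
    filter_upwards [pd_const_mul hU ν (h1.add hU h2) j, pd_add hU h1 h2 j, (hv i).pd_pd hU j j,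
      (hv j).pd_pd hU i j] with x e1 e2 e3 e4
    rw [e1, e2, Pi.add_apply, e3, e4]
  filter_upwards [ae_all_iff.2 fun i => ae_all_iff.2 fun j => key i j] with x hx i
  simp only [viscDiv, hx, Finset.mul_sum]

theorem viscDiv_sub (hU : IsOpen U) (hv : MemHVec U 2 v) (hw : MemHVec U 2 w) (ν : ℝ) :
    ∀ᵐ x ∂volume.restrict U, ∀ i,
      viscDiv U ν (v - w) i x = viscDiv U ν v i x - viscDiv U ν w i x := by
  have key : ∀ i j, ∀ᵐ x ∂volume.restrict U, pd U j (fun y => 2 * ν * symGrad U (v - w) i j y) x =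
      pd U j (fun y => 2 * ν * symGrad U v i j y) x -
        pd U j (fun y => 2 * ν * symGrad U w i j y) x := by
    intro i j
    have hd := ((memH_symGrad hU hv ν i j).pd_isWeakDeriv j).sub hU
      ((memH_symGrad hU hw ν i j).pd_isWeakDeriv j)
    refine (hd.congr_left (h' := fun y => 2 * ν * symGrad U (v - w) i j y) ?_
      (locallyIntegrableOn_of_memLp (memH_symGrad hU (hv.sub hU hw) ν i j).1)).weakDeriv_ae_eq hU
    filter_upwards [symGrad_sub hU (hv.of_le one_le_two) (hw.of_le one_le_two)] with x hx
    simp only [hx, Pi.sub_apply]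
    ring
  filter_upwards [ae_all_iff.2 fun i => ae_all_iff.2 fun j => key i j] with x hx i
  simp only [viscDiv, hx, Finset.sum_sub_distrib]

/-! ### Bilinear forms -/

theorem VSpace.memHVec (hv : v ∈ VSpace U) : MemHVec U 1 v := fun i => (hv i).1

theorem integrable_sum_mul {X ι : Type*} [Fintype ι] [MeasurableSpace X] {μ : Measure X}
    {g h : ι → X → ℝ} (hg : ∀ i, MemLp (g i) 2 μ) (hh : ∀ i, MemLp (h i) 2 μ) :
    Integrable (fun x => ∑ i, g i x * h i x) μ :=
  integrable_finsetSum _ fun i _ => integrable_mul_of_memLp (hg i) (hh i)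

theorem integrable_formC (hU : IsOpen U) (hv : MemHVec U 1 v) (hw : MemHVec U 1 w) (a : E d) :
    IntegrableOn (fun x => ∑ i, adv U a v i x * w x i) U :=
  integrable_sum_mul (fun i => memLp_adv hU hv a i) fun i => (hw i).1

theorem integrable_formK (hU : IsOpen U) (hv : MemHVec U 1 v) (hw : MemHVec U 1 w) (ν : ℝ) :
    IntegrableOn (fun x => ∑ i, ∑ j, 2 * ν * symGrad U v i j x * symGrad U w i j x) U :=
  integrable_finsetSum _ fun i _ => integrable_sum_mul
    (fun j => (memLp_symGrad hU hv i j).const_mul (2 * ν)) fun j => memLp_symGrad hU hw i j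

theorem formC_sub_left (hU : IsOpen U) {v' : E d → E d} (hv : MemHVec U 1 v)
    (hv' : MemHVec U 1 v') (hw : MemHVec U 1 w) (a : E d) :
    formC U a (v - v') w = formC U a v w - formC U a v' w := by
  unfold formC
  rw [← integral_sub (integrable_formC hU hv hw a) (integrable_formC hU hv' hw a)]
  refine integral_congr_ae ?_
  filter_upwards [adv_sub hU hv hv' a] with x hx
  simp only [hx, sub_mul, Finset.sum_sub_distrib]

theorem formK_sub_left (hU : IsOpen U) {v' : E d → E d} (hv : MemHVec U 1 v)
    (hv' : MemHVec U 1 v') (hw : MemHVec U 1 w) (ν : ℝ) :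
    formK U ν (v - v') w = formK U ν v w - formK U ν v' w := by
  unfold formK
  rw [← integral_sub (integrable_formK hU hv hw ν) (integrable_formK hU hv' hw ν)]
  refine integral_congr_ae ?_
  filter_upwards [symGrad_sub hU hv hv'] with x hx
  simp only [hx, mul_sub, sub_mul, Finset.sum_sub_distrib]

/-- The difference of the approximating test functions approximates the difference of the fields.
Tolerances `ε / 4` suffice because `(A - B)² ≤ 2 A² + 2 B²`. -/
theorem VSpace.sub_mem (hU : IsOpen U) (hv : v ∈ VSpace U) (hw : w ∈ VSpace U) :
    v - w ∈ VSpace U := by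
  intro i
  refine ⟨(hv i).1.sub hU (hw i).1, fun ε hε => ?_⟩
  obtain ⟨φ, hφ, h1⟩ := (hv i).2 (ε / 4) (by positivity)
  obtain ⟨ψ, hψ, h2⟩ := (hw i).2 (ε / 4) (by positivity)
  have hsub : IsTestFunction U (φ - ψ) := by
    refine ⟨hφ.1.sub hψ.1, hφ.2.1.sub hψ.2.1, ?_⟩
    exact (tsupport_sub _ _).trans (union_subset hφ.2.2 hψ.2.2)
  refine ⟨φ - ψ, hsub, ?_⟩
  have key : ∀ {A B A' B' C : E d → ℝ}, MemLp A 2 (volume.restrict U) →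
      MemLp B 2 (volume.restrict U) → MemLp A' 2 (volume.restrict U) →
      MemLp B' 2 (volume.restrict U) → (∀ᵐ x ∂volume.restrict U, C x = (A x - A' x) - (B x - B' x)) →
      ∫ x in U, C x ^ 2 ≤ 2 * (∫ x in U, (A x - A' x) ^ 2) + 2 * ∫ x in U, (B x - B' x) ^ 2 := by
    intro A B A' B' C hA hB hA' hB' hC
    have hiA : IntegrableOn (fun x => 2 * (A x - A' x) ^ 2) U :=
      (hA.sub hA').integrable_sq.const_mul 2
    have hiB : IntegrableOn (fun x => 2 * (B x - B' x) ^ 2) U :=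
      (hB.sub hB').integrable_sq.const_mul 2
    rw [← integral_const_mul, ← integral_const_mul, ← integral_add hiA hiB]
    refine integral_mono_of_nonneg (ae_of_all _ fun x => sq_nonneg _) (hiA.add hiB) ?_
    filter_upwards [hC] with x hx
    simp only [hx]
    nlinarith [sq_nonneg ((A x - A' x) + (B x - B' x))]
  have k1 : ∫ x in U, ((v - w) x i - (φ - ψ) x) ^ 2 ≤
      2 * (∫ x in U, (v x i - φ x) ^ 2) + 2 * ∫ x in U, (w x i - ψ x) ^ 2 :=
    key (hv i).1.1 (hw i).1.1 hφ.memLp hψ.memLp (ae_of_all _ fun x => by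
      simp only [Pi.sub_apply, PiLp.sub_apply]; ring)
  have k2 : ∀ j : Fin d, ∫ x in U,
      (weakDeriv U ![j] (fun x => (v - w) x i) x - fderiv ℝ (φ - ψ) x (basisVec j)) ^ 2 ≤
      2 * (∫ x in U, (weakDeriv U ![j] (fun x => v x i) x - fderiv ℝ φ x (basisVec j)) ^ 2) +
      2 * ∫ x in U, (weakDeriv U ![j] (fun x => w x i) x - fderiv ℝ ψ x (basisVec j)) ^ 2 := by
    intro j
    refine key ((hv i).1.pd_memLp hU j) ((hw i).1.pd_memLp hU j) (hφ.fderiv_apply _).memLp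
      (hψ.fderiv_apply _).memLp ?_
    filter_upwards [pd_comp_sub hU (VSpace.memHVec hv) (VSpace.memHVec hw) i j] with x hx
    rw [pd] at hx
    rw [hx, fderiv_sub (hφ.1.differentiable (by simp) x) (hψ.1.differentiable (by simp) x)]
    simp only [Pi.sub_apply, _root_.sub_apply, pd]
    ring
  have k3 := Finset.sum_le_sum fun j (_ : j ∈ Finset.univ) => k2 j
  rw [Finset.sum_add_distrib, ← Finset.mul_sum, ← Finset.mul_sum] at k3
  linarith

theorem VDivFree.sub_mem (hU : IsOpen U) (hv : v ∈ VDivFree U) (hw : w ∈ VDivFree U) :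
    v - w ∈ VDivFree U := by
  refine ⟨VSpace.sub_mem hU hv.1 hw.1, ?_⟩
  filter_upwards [divg_sub hU (VSpace.memHVec hv.1) (VSpace.memHVec hw.1), hv.2, hw.2]
    with x h1 h2 h3
  rw [h1, h2, h3, sub_zero]

/-- The convective form is skew-symmetric. -/
theorem formC_antisymm (hU : IsOpen U) (hv : v ∈ VSpace U) (hw : MemHVec U 1 w) (a : E d) :
    formC U a v w = -formC U a w v := by
  have hv1 := VSpace.memHVec hv
  have key : ∀ {v w : E d → E d}, MemHVec U 1 v → MemHVec U 1 w →
      formC U a v w = ∑ i, ∑ j, a j * ∫ x in U, pd U j (fun y => v y i) x * w x i := by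
    intro v w hv hw
    unfold formC
    rw [integral_finsetSum _ fun i _ => integrable_mul_of_memLp (memLp_adv hU hv a i) (hw i).1]
    refine Finset.sum_congr rfl fun i _ => ?_
    simp only [adv, Finset.sum_mul, mul_assoc]
    rw [integral_finsetSum _ fun j _ =>
      (integrable_mul_of_memLp ((hv i).pd_memLp hU j) (hw i).1).const_mul (a j)]
    exact Finset.sum_congr rfl fun j _ => integral_const_mul _ _
  rw [key hv1 hw, key hw hv1, ← Finset.sum_neg_distrib]
  refine Finset.sum_congr rfl fun i _ => ?_
  rw [← Finset.sum_neg_distrib]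
  refine Finset.sum_congr rfl fun j _ => ?_
  rw [(hv i).integral_pd_mul hU (hw i) j]
  simp only [mul_comm (v _ i)]
  ring

/-- Gradients are orthogonal to the divergence-free fields. -/
theorem integral_grad_mul_eq_zero (hU : IsOpen U) (hv : v ∈ VDivFree U) (hr : MemH U 1 r) :
    ∫ x in U, ∑ i, pd U i r x * v x i = 0 := by
  have hv1 := VSpace.memHVec hv.1
  rw [integral_finsetSum _ fun i _ => integrable_mul_of_memLp (hr.pd_memLp hU i) (hv1 i).1]
  have h : ∀ i, ∫ x in U, pd U i r x * v x i = -∫ x in U, pd U i (fun y => v y i) x * r x := by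
    intro i
    rw [(hv.1 i).integral_pd_mul hU hr i, neg_neg]
    simp only [mul_comm (v _ i)]
  simp only [h]
  rw [Finset.sum_neg_distrib, ← integral_finsetSum _ fun i _ =>
    integrable_mul_of_memLp ((hv1 i).pd_memLp hU i) hr.1, neg_eq_zero,
    ← integral_zero (E d) ℝ (μ := volume.restrict U)]
  refine integral_congr_ae ?_
  filter_upwards [hv.2] with x hx
  rw [← Finset.sum_mul]
  simp only [divg] at hx
  rw [hx, zero_mul]

/-- The two integrands differ by `∇(a · w) · v`, which integrates to zero because `v` is
divergence-free. Hence the symmetric gradient alone controls the convective form. -/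
theorem formC_eq_integral_symGrad (hU : IsOpen U) (hw : MemHVec U 1 w) (hv : v ∈ VDivFree U)
    (a : E d) : formC U a w v = ∫ x in U, ∑ i, (∑ j, 2 * a j * symGrad U w i j x) * v x i := by
  have hv1 := VSpace.memHVec hv.1
  have hsg : ∀ i, MemLp (fun x => ∑ j, 2 * a j * symGrad U w i j x) 2 (volume.restrict U) :=
    fun i => memLp_finsetSum _ fun j _ => (memLp_symGrad hU hw i j).const_mul _
  have h0 : ∫ x in U, ∑ j, a j * ∑ i, pd U i (fun y => w y j) x * v x i = 0 := by
    rw [integral_finsetSum _ fun j _ => (integrable_sum_mul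
      (fun i => (hw j).pd_memLp hU i) fun i => (hv1 i).1).const_mul (a j)]
    refine Finset.sum_eq_zero fun j _ => ?_
    rw [integral_const_mul, integral_grad_mul_eq_zero hU hv (hw j), mul_zero]
  rw [← sub_zero (∫ x in U, ∑ i, (∑ j, 2 * a j * symGrad U w i j x) * v x i), ← h0,
    ← integral_sub (integrable_sum_mul hsg fun i => (hv1 i).1)
      (integrable_finsetSum _ fun j _ => (integrable_sum_mul
        (fun i => (hw j).pd_memLp hU i) fun i => (hv1 i).1).const_mul (a j))]
  refine integral_congr_ae (ae_of_all _ fun x => ?_)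
  simp only [adv, symGrad, Finset.mul_sum, Finset.sum_mul]
  rw [Finset.sum_comm (f := fun j i => a j * (pd U i (fun y => w y j) x * v x i)),
    ← Finset.sum_sub_distrib]
  refine Finset.sum_congr rfl fun i _ => ?_
  rw [← Finset.sum_sub_distrib]
  refine Finset.sum_congr rfl fun j _ => ?_
  ring

theorem VDivFree.of_formB (hU : IsOpen U) (hv : v ∈ VSpace U)
    (h : formB U v (divg U v) = 0) : v ∈ VDivFree U := by
  refine ⟨hv, ?_⟩
  unfold formB at h
  have h2 := (integral_eq_zero_iff_of_nonneg (fun x => mul_self_nonneg (divg U v x))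
    (integrable_mul_of_memLp (memLp_divg hU (VSpace.memHVec hv))
      (memLp_divg hU (VSpace.memHVec hv)))).1 h
  filter_upwards [h2] with x hx
  simpa using hx

theorem formB_eq_zero (hv : v ∈ VDivFree U) (q : E d → ℝ) : formB U v q = 0 := by
  rw [formB, ← integral_zero (E d) ℝ (μ := volume.restrict U)]
  refine integral_congr_ae ?_
  filter_upwards [hv.2] with x hx
  rw [hx, zero_mul]

end Operators

/-! ### Exact solutions -/

section Exact

variable {d : ℕ} {U V Ω : Set (E d)} {a : E d} {ν : ℝ} {F u v w : E d → E d} {p q r : E d → ℝ}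

theorem zero_mem_VSpace (hU : IsOpen U) : (0 : E d → E d) ∈ VSpace U :=
  fun _ => IsTestFunction.zero.memH10 hU

theorem zero_mem_QSpace : (0 : E d → ℝ) ∈ QSpace U := ⟨MemLp.zero, by simp⟩

theorem pd_comp_zero (hU : IsOpen U) : ∀ᵐ x ∂volume.restrict U, ∀ i j,
    pd U j (fun y => (0 : E d → E d) y i) x = 0 :=
  ae_all_iff.2 fun _ => ae_all_iff.2 fun j => pd_zero hU j

/-- The mean value zero makes the divergence an admissible pressure test function. -/
theorem divg_mem_QSpace (hU : IsOpen U) (hbd : Bornology.IsBounded U) (hv : v ∈ VSpace U) :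
    divg U v ∈ QSpace U := by
  have hfin : IsFiniteMeasure (volume.restrict U) := ⟨by
    rw [Measure.restrict_apply_univ]; exact hbd.measure_lt_top⟩
  refine ⟨memLp_divg hU (VSpace.memHVec hv), ?_⟩
  unfold divg
  rw [integral_finsetSum _ fun i _ => ((hv i).1.pd_memLp hU i).integrable (by norm_num)]
  exact Finset.sum_eq_zero fun i _ => (hv i).integral_pd_eq_zero hU hbd i

theorem IsOseenSolution.mem_VDivFree (hΩ : IsOpen Ω) (hbd : Bornology.IsBounded Ω)
    (h : IsOseenSolution Ω a ν F u p) : u ∈ VDivFree Ω := by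
  refine VDivFree.of_formB hΩ h.1 ?_
  -- Testing with zero velocity and pressure `∇ · u` leaves only `‖∇ · u‖² = 0`.
  have e := h.2.2 0 (zero_mem_VSpace hΩ) _ (divg_mem_QSpace hΩ hbd h.1)
  have h1 : formC Ω a u 0 = 0 := by simp [formC]
  have h2 : formK Ω ν u 0 = 0 := by
    rw [formK, ← integral_zero (E d) ℝ (μ := volume.restrict Ω)]
    refine integral_congr_ae ?_
    filter_upwards [pd_comp_zero hΩ] with x hx
    simp only [symGrad, hx, add_zero, zero_div, mul_zero, Finset.sum_const_zero]
  have h3 : formB Ω 0 p = 0 := by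
    rw [formB, ← integral_zero (E d) ℝ (μ := volume.restrict Ω)]
    refine integral_congr_ae ?_
    filter_upwards [pd_comp_zero hΩ] with x hx
    simp only [divg, hx, Finset.sum_const_zero, zero_mul]
  have h4 : innerL2 Ω F 0 = 0 := by simp [innerL2]
  rw [h1, h2, h3, h4] at e
  linarith

theorem IsOseenSolution.galerkin (h : IsOseenSolution Ω a ν F u p) (hw : w ∈ VDivFree Ω) :
    formC Ω a u w + formK Ω ν u w = innerL2 Ω F w := by
  have e := h.2.2 w hw.1 0 zero_mem_QSpace
  rw [formB_eq_zero hw] at e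
  have h3 : formB Ω u 0 = 0 := by simp [formB]
  rw [h3] at e
  linarith

theorem memLp_comp (hF : MemLp F 2 (volume.restrict U)) (i : Fin d) :
    MemLp (fun x => F x i) 2 (volume.restrict U) :=
  (EuclideanSpace.proj (𝕜 := ℝ) i).comp_memLp' hF

/-- A regular solution satisfies the momentum equation almost everywhere. -/
theorem IsOseenSolution.momentum (hΩ : IsOpen Ω) (hV : IsOpen V) (hVΩ : V ⊆ Ω)
    (h : IsOseenSolution Ω a ν F u p) (hF : MemLp F 2 (volume.restrict Ω))
    (hu : MemHVec Ω 2 u) (hp : MemH Ω 1 p) :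
    ∀ᵐ x ∂volume.restrict V, ∀ i,
      adv Ω a u i x - viscDiv V ν u i x + pd Ω i p x = F x i := by
  have hu1 := hu.of_le one_le_two
  refine ae_all_iff.2 fun i => ?_
  have hG : MemLp (fun x => adv Ω a u i x + pd Ω i p x - F x i) 2 (volume.restrict Ω) :=
    ((memLp_adv hΩ hu1 a i).add (hp.pd_memLp hΩ i)).sub (memLp_comp hF i)
  have hGV := hG.restrict_mono hVΩ
  have hvisc := memLp_viscDiv hV (hu.mono hΩ hVΩ) ν i
  have key : (fun x => (adv Ω a u i x + pd Ω i p x - F x i) - viscDiv V ν u i x)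
      =ᵐ[volume.restrict V] 0 := by
    refine ae_eq_zero_of_forall_isTestFunction hV
      (locallyIntegrableOn_of_memLp (hGV.sub hvisc)) fun φ hφV => ?_
    have hφ := hφV.mono hVΩ
    have hφ' : ∀ j, IsTestFunction Ω (fun x => fderiv ℝ φ x (basisVec j)) :=
      fun j => hφ.fderiv_apply _
    -- A test field supported in `V` with only its `i`-th component nonzero isolates the `i`-th
    -- momentum equation.
    set v : E d → E d := fun x => EuclideanSpace.single i (φ x) with hv
    have hvi : ∀ j, (fun x => v x j) = if j = i then φ else 0 := by
      intro j
      ext x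
      by_cases hj : j = i <;> simp [hv, hj]
    have hpdv : ∀ᵐ x ∂volume.restrict Ω, ∀ j k, pd Ω k (fun y => v y j) x =
        if j = i then fderiv ℝ φ x (basisVec k) else 0 := by
      refine ae_all_iff.2 fun j => ae_all_iff.2 fun k => ?_
      rw [hvi j]
      by_cases hj : j = i
      · simp only [hj, if_true]
        exact hφ.pd_ae_eq hΩ k
      · simp only [hj, if_false]
        exact pd_zero hΩ k
    have hvV : v ∈ VSpace Ω := by
      intro j
      rw [hvi j]
      by_cases hj : j = i
      · simpa only [hj, if_true] using hφ.memH10 hΩ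
      · simpa only [hj, if_false] using IsTestFunction.zero.memH10 hΩ
    have e := h.2.2 v hvV 0 zero_mem_QSpace
    have h0 : formB Ω u 0 = 0 := by simp [formB]
    have hC : formC Ω a u v = ∫ x in Ω, adv Ω a u i x * φ x := by
      unfold formC
      congr 1
      ext x
      simp [hv]
    have hI : innerL2 Ω F v = ∫ x in Ω, F x i * φ x := by
      unfold innerL2
      congr 1
      ext x
      simp [hv]
    have hB : formB Ω v p = -∫ x in Ω, pd Ω i p x * φ x := by
      rw [← (isWeakDeriv_one_iff.1 (hp.pd_isWeakDeriv i)).2.2 φ hφ]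
      unfold formB
      refine integral_congr_ae ?_
      filter_upwards [hpdv] with x hx
      simp [divg, hx, mul_comm]
    have hK : formK Ω ν u v = -∫ x in V, viscDiv V ν u i x * φ x := by
      have k1 : formK Ω ν u v =
          ∫ x in Ω, ∑ l, 2 * ν * symGrad Ω u i l x * fderiv ℝ φ x (basisVec l) := by
        unfold formK
        refine integral_congr_ae ?_
        filter_upwards [hpdv] with x hx
        -- Only row `i` of the gradient of `v` is nonzero, so its symmetric part lives in row `i`
        -- and column `i`. By symmetry both contribute equally after summation.
        have h1 : ∀ k l, 2 * ν * symGrad Ω u k l x * symGrad Ω v k l x =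
            (if k = i then ν * symGrad Ω u i l x * fderiv ℝ φ x (basisVec l) else 0) +
            (if l = i then ν * symGrad Ω u i k x * fderiv ℝ φ x (basisVec k) else 0) := by
          intro k l
          rw [symGrad, symGrad, hx, hx]
          by_cases hk : k = i <;> by_cases hl : l = i <;> simp [hk, hl, symGrad] <;> ring
        simp only [h1, Finset.sum_add_distrib, Finset.sum_ite_eq', Finset.mem_univ, if_true]
        rw [Finset.sum_comm]
        simp only [Finset.sum_ite_eq', Finset.mem_univ, if_true, ← Finset.sum_add_distrib]
        exact Finset.sum_congr rfl fun l _ => by ring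
      have k2 : ∫ x in V, viscDiv V ν u i x * φ x =
          ∑ l, ∫ x in V, pd V l (fun y => 2 * ν * symGrad V u i l y) x * φ x := by
        simp only [viscDiv, Finset.sum_mul]
        exact integral_finsetSum _ fun l _ => integrable_mul_of_memLp
          ((memH_symGrad hV (hu.mono hΩ hVΩ) ν i l).pd_memLp hV l) hφV.memLp
      rw [k1, k2, ← Finset.sum_neg_distrib, integral_finsetSum _ fun l _ =>
        integrable_mul_of_memLp ((memLp_symGrad hΩ hu1 i l).const_mul (2 * ν)) (hφ' l).memLp]
      refine Finset.sum_congr rfl fun l _ => ?_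
      rw [← (isWeakDeriv_one_iff.1
        ((memH_symGrad hV (hu.mono hΩ hVΩ) ν i l).pd_isWeakDeriv l)).2.2 φ hφV,
        setIntegral_mul_eq_of_tsupport hΩ hVΩ (hφV.fderiv_apply _).2.2]
      refine integral_congr_ae ?_
      filter_upwards [symGrad_restrict hΩ hV hVΩ hu1] with x hx
      rw [hx]
    rw [h0, hC, hK, hB, hI] at e
    have hsplit : ∫ x in Ω, (adv Ω a u i x + pd Ω i p x - F x i) * φ x =
        (∫ x in Ω, adv Ω a u i x * φ x) + (∫ x in Ω, pd Ω i p x * φ x) -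
          ∫ x in Ω, F x i * φ x := by
      have i1 := integrable_mul_of_memLp (memLp_adv hΩ hu1 a i) hφ.memLp
      have i2 := integrable_mul_of_memLp (hp.pd_memLp hΩ i) hφ.memLp
      have i3 := integrable_mul_of_memLp (memLp_comp hF i) hφ.memLp
      have i4 : IntegrableOn (fun x => adv Ω a u i x * φ x + pd Ω i p x * φ x) Ω := i1.add i2
      rw [← integral_add i1 i2, ← integral_sub i4 i3]
      simp only [add_mul, sub_mul]
    rw [setIntegral_mul_eq_of_tsupport hΩ hVΩ hφV.2.2] at hsplit
    simp only [sub_mul _ (viscDiv _ _ _ _ _)]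
    rw [integral_sub (integrable_mul_of_memLp hGV hφV.memLp)
      (integrable_mul_of_memLp hvisc hφV.memLp), hsplit]
    linarith
  filter_upwards [key] with x hx
  simp only [Pi.zero_apply] at hx
  linarith

end Exact

/-! ### Meshes -/

section Mesh

variable {d n : ℕ} {Ω : Set (E d)}

theorem Mesh.isOpen (M : Mesh Ω n) : IsOpen Ω := by
  rw [M.domain_eq]
  exact isOpen_interior

theorem Mesh.elem_subset (M : Mesh Ω n) (e : Fin n) : M.elem e ⊆ Ω :=
  (interior_maximal (subset_closure.trans (subset_iUnion (fun e => closure (M.elem e)) e))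
    (M.isOpen_elem e)).trans M.domain_eq.ge

/-- A point of the domain outside all elements lies in the closure of one of them, hence on its
frontier, and the frontiers are null. -/
theorem Mesh.iUnion_ae_eq (M : Mesh Ω n) : (⋃ e, M.elem e) =ᵐ[volume] Ω := by
  refine (LE.le.eventuallyLE (iUnion_subset M.elem_subset)).antisymm ?_
  have h0 : volume (⋃ e, frontier (M.elem e)) = 0 := measure_iUnion_null M.null_frontier
  refine ae_le_set.2 (measure_mono_null (fun x hx => ?_) h0)
  have hx1 : x ∈ ⋃ e, closure (M.elem e) := by
    have := hx.1
    rw [M.domain_eq] at this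
    exact interior_subset this
  obtain ⟨e, he⟩ := mem_iUnion.1 hx1
  refine mem_iUnion.2 ⟨e, he, fun hi => hx.2 (mem_iUnion.2 ⟨e, interior_subset hi⟩)⟩

theorem Mesh.setIntegral_eq_sum (M : Mesh Ω n) {g : E d → ℝ} (hg : IntegrableOn g Ω) :
    ∫ x in Ω, g x = ∑ e, ∫ x in M.elem e, g x := by
  rw [← setIntegral_congr_set M.iUnion_ae_eq]
  exact integral_iUnion_fintype (fun e => (M.isOpen_elem e).measurableSet)
    (fun e e' h => M.disjoint_elem e e' h) fun e => hg.mono_set (M.elem_subset e)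

/-- A nonzero `a` excludes dimension zero, so a nonempty open element has more than one point;
boundedness keeps its diameter from degenerating to the default value `0`. -/
theorem Mesh.he_pos (M : Mesh Ω n) (hbd : Bornology.IsBounded Ω) {a : E d} (ha : a ≠ 0)
    (e : Fin n) : 0 < M.he e := by
  have : Nontrivial (E d) := ⟨a, 0, ha⟩
  obtain ⟨x, hx⟩ := M.nonempty_elem e
  have hinf : (M.elem e).Infinite := by
    have := Module.punctured_nhds_neBot ℝ (E d) x
    exact infinite_of_mem_nhds x ((M.isOpen_elem e).mem_nhds hx)
  exact Metric.diam_pos hinf.nontrivial (hbd.subset (M.elem_subset e))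

theorem Mesh.he_le_h (M : Mesh Ω n) (e : Fin n) : M.he e ≤ M.h :=
  le_ciSup (Finite.bddAbove_range M.he) e

theorem Mesh.nonempty_index (M : Mesh Ω n) (hne : Ω.Nonempty) : Nonempty (Fin n) := by
  by_contra hn
  rw [not_nonempty_iff] at hn
  rw [M.domain_eq] at hne
  simp at hne

theorem Mesh.QuasiUniform.h_le {M : Mesh Ω n} {C : ℝ} (h : M.QuasiUniform C)
    (hne : Ω.Nonempty) (e : Fin n) : M.h ≤ C * M.he e := by
  have := M.nonempty_index hne
  exact ciSup_le fun e' => h e' e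

end Mesh

/-! ### The stabilization pairing -/

section Pairing

variable {d n : ℕ} {Ω : Set (E d)} {M : Mesh Ω n} {τM : Fin n → ℝ}
  {A A₁ A₂ B : Fin n → Fin d → E d → ℝ} {a : E d} {ν : ℝ} {F u v w : E d → E d} {p q r : E d → ℝ}

/-- The sum over the elements of the inner products `(A, τ_M B)` of elementwise vector fields. -/
noncomputable def stabPairing (M : Mesh Ω n) (τM : Fin n → ℝ) (A B : Fin n → Fin d → E d → ℝ) : ℝ :=
  ∑ e, ∫ x in M.elem e, ∑ i, A e i x * (τM e * B e i x)

/-- The elementwise vector field is square integrable on each element. -/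
def ElemL2 (M : Mesh Ω n) (A : Fin n → Fin d → E d → ℝ) : Prop :=
  ∀ e i, MemLp (A e i) 2 (volume.restrict (M.elem e))

/-- The field `a · ∇ v + ∇ q`. -/
noncomputable def convField (n : ℕ) (Ω : Set (E d)) (a : E d) (v : E d → E d) (q : E d → ℝ) :
    Fin n → Fin d → E d → ℝ :=
  fun _ i x => adv Ω a v i x + pd Ω i q x

/-- The elementwise field `∇ · (2 ν ∇^s v)`. -/
noncomputable def viscField (M : Mesh Ω n) (ν : ℝ) (v : E d → E d) : Fin n → Fin d → E d → ℝ :=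
  fun e i => viscDiv (M.elem e) ν v i

theorem ElemL2.convField (hv : MemHVec Ω 1 v) (hq : MemH Ω 1 q) :
    ElemL2 M (convField n Ω a v q) := fun e i =>
  ((memLp_adv M.isOpen hv a i).add (hq.pd_memLp M.isOpen i)).restrict_mono (M.elem_subset e)

theorem ElemL2.viscField (hv : ∀ e, MemHVec (M.elem e) 2 v) : ElemL2 M (viscField M ν v) :=
  fun e i => memLp_viscDiv (M.isOpen_elem e) (hv e) ν i

theorem ElemL2.integrable_pairing (hA : ElemL2 M A) (hB : ElemL2 M B) (e : Fin n) :
    IntegrableOn (fun x => ∑ i, A e i x * (τM e * B e i x)) (M.elem e) :=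
  integrable_sum_mul (hA e) fun i => (hB e i).const_mul (τM e)

/-- Linearity in the first slot, with the splitting required only almost everywhere on each element,
since weak derivatives satisfy it only in that sense. -/
theorem stabPairing_eq_sub (hA₁ : ElemL2 M A₁) (hA₂ : ElemL2 M A₂) (hB : ElemL2 M B)
    (h : ∀ e, ∀ᵐ x ∂volume.restrict (M.elem e), ∀ i, A e i x = A₁ e i x - A₂ e i x) :
    stabPairing M τM A B = stabPairing M τM A₁ B - stabPairing M τM A₂ B := by
  unfold stabPairing
  rw [← Finset.sum_sub_distrib]
  refine Finset.sum_congr rfl fun e _ => ?_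
  rw [← integral_sub (hA₁.integrable_pairing hB e) (hA₂.integrable_pairing hB e)]
  refine integral_congr_ae ?_
  filter_upwards [h e] with x hx
  simp only [hx, sub_mul, Finset.sum_sub_distrib]

theorem stabPairing_self (M : Mesh Ω n) (τM : Fin n → ℝ) (A : Fin n → Fin d → E d → ℝ) :
    stabPairing M τM A A = ∑ e, τM e * ∫ x in M.elem e, ∑ i, A e i x ^ 2 := by
  unfold stabPairing
  refine Finset.sum_congr rfl fun e _ => ?_
  rw [← integral_const_mul]
  congr 1
  ext x
  rw [Finset.mul_sum]
  exact Finset.sum_congr rfl fun i _ => by ring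

theorem abs_mul_le_young {δ : ℝ} (hδ : 0 < δ) (s t : ℝ) :
    |s * t| ≤ δ * s ^ 2 + 1 / (4 * δ) * t ^ 2 := by
  have h : δ * s ^ 2 + 1 / (4 * δ) * t ^ 2 = ((δ * s) ^ 2 + (t / 2) ^ 2) / δ := by
    field_simp
    ring
  have h2 : s * t = 2 * ((δ * s) * (t / 2)) / δ := by
    field_simp
  rw [h, h2, abs_div, abs_of_pos hδ]
  exact div_le_div_of_nonneg_right (abs_le.2 ⟨by nlinarith [sq_nonneg (δ * s + t / 2)],
    by nlinarith [sq_nonneg (δ * s - t / 2)]⟩) hδ.le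

/-- Young's inequality with a free weight `δ`; later choices of `δ` decide how much of the discrete
error is absorbed. -/
theorem abs_stabPairing_le (hτ : ∀ e, 0 ≤ τM e) (hA : ElemL2 M A) (hB : ElemL2 M B) {δ : ℝ}
    (hδ : 0 < δ) : |stabPairing M τM A B| ≤
      δ * stabPairing M τM A A + 1 / (4 * δ) * stabPairing M τM B B := by
  unfold stabPairing
  rw [Finset.mul_sum, Finset.mul_sum, ← Finset.sum_add_distrib]
  refine (Finset.abs_sum_le_sum_abs _ _).trans (Finset.sum_le_sum fun e _ => ?_)
  have iA := (hA.integrable_pairing (τM := τM) hA e).const_mul δ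
  have iB := (hB.integrable_pairing (τM := τM) hB e).const_mul (1 / (4 * δ))
  rw [← integral_const_mul, ← integral_const_mul, ← integral_add iA iB]
  refine (abs_integral_le_integral_abs).trans
    (integral_mono (hA.integrable_pairing hB e).abs (iA.add iB) fun x => ?_)
  beta_reduce
  rw [Finset.mul_sum, Finset.mul_sum, ← Finset.sum_add_distrib]
  refine (Finset.abs_sum_le_sum_abs _ _).trans (Finset.sum_le_sum fun i _ => ?_)
  have h : A e i x * (τM e * B e i x) = τM e * (A e i x * B e i x) := by ring
  rw [h, abs_mul, abs_of_nonneg (hτ e)]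
  refine (mul_le_mul_of_nonneg_left (abs_mul_le_young hδ _ _) (hτ e)).trans (le_of_eq ?_)
  ring

theorem stabPairing_self_nonneg (hτ : ∀ e, 0 ≤ τM e) (A : Fin n → Fin d → E d → ℝ) :
    0 ≤ stabPairing M τM A A := by
  rw [stabPairing_self]
  exact Finset.sum_nonneg fun e _ => mul_nonneg (hτ e)
    (integral_nonneg fun x => Finset.sum_nonneg fun i _ => sq_nonneg _)

theorem tripleNormSq_eq (M : Mesh Ω n) (a : E d) (ν : ℝ) (τM : Fin n → ℝ) (v : E d → E d)
    (q : E d → ℝ) : tripleNormSq M a ν τM v q =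
      formK Ω ν v v + stabPairing M τM (convField n Ω a v q) (convField n Ω a v q) := rfl

theorem convField_sub (hv : MemHVec Ω 1 v) (hw : MemHVec Ω 1 w) (hq : MemH Ω 1 q)
    (hr : MemH Ω 1 r) (M : Mesh Ω n) (a : E d) (e : Fin n) :
    ∀ᵐ x ∂volume.restrict (M.elem e), ∀ i, convField n Ω a (v - w) (q - r) e i x =
      convField n Ω a v q e i x - convField n Ω a w r e i x := by
  refine ae_restrict_of_ae_restrict_of_subset (M.elem_subset e) ?_
  filter_upwards [adv_sub M.isOpen hv hw a, ae_forall_pd_sub M.isOpen hq hr] with x h1 h2 i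
  simp only [convField, h1, h2]
  ring

theorem viscField_sub (hv : ∀ e, MemHVec (M.elem e) 2 v) (hw : ∀ e, MemHVec (M.elem e) 2 w)
    (ν : ℝ) (e : Fin n) : ∀ᵐ x ∂volume.restrict (M.elem e), ∀ i,
      viscField M ν (v - w) e i x = viscField M ν v e i x - viscField M ν w e i x :=
  viscDiv_sub (M.isOpen_elem e) (hv e) (hw e) ν

/-! ### Discrete spaces -/

theorem DiscreteSpaces.VhDivFree_sub_mem {S : DiscreteSpaces M} (hv : v ∈ S.VhDivFree)
    (hw : w ∈ S.VhDivFree) : v - w ∈ S.VhDivFree := by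
  refine ⟨S.Vh.sub_mem hv.1 hw.1, fun q hq => ?_⟩
  have hv1 := VSpace.memHVec (S.Vh_subset v hv.1)
  have hw1 := VSpace.memHVec (S.Vh_subset w hw.1)
  have hq1 := (S.Qh_subset q hq).1
  have : formB Ω (v - w) q = formB Ω v q - formB Ω w q := by
    unfold formB
    rw [← integral_sub (integrable_mul_of_memLp (memLp_divg M.isOpen hv1) hq1)
      (integrable_mul_of_memLp (memLp_divg M.isOpen hw1) hq1)]
    refine integral_congr_ae ?_
    filter_upwards [divg_sub M.isOpen hv1 hw1] with x hx
    rw [hx, sub_mul]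
  rw [this, hv.2 q hq, hw.2 q hq, sub_zero]

/-- With divergence-conforming spaces the discretely divergence-free fields are divergence-free. -/
theorem DiscreteSpaces.DivConforming.mem_VDivFree {S : DiscreteSpaces M} (h : S.DivConforming)
    (hv : v ∈ S.VhDivFree) : v ∈ VDivFree Ω := by
  refine VDivFree.of_formB M.isOpen (S.Vh_subset v hv.1) ?_
  obtain ⟨q, hq, he⟩ := h v hv.1
  rw [← hv.2 q hq]
  unfold formB
  refine integral_congr_ae ?_
  filter_upwards [he] with x hx
  rw [hx]

theorem DiscreteSpaces.memH_of_mem_Qtot {S : DiscreteSpaces M} (hq : q ∈ S.Qtot) : MemH Ω 1 q := by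
  rw [DiscreteSpaces.Qtot, sup_eq_right.2 S.Qh_le_Qf] at hq
  exact S.Qf_subset q hq

/-- The error equation, tested with the difference of the discrete solution and an arbitrary
discrete pair `(v, q)`. -/
theorem error_identity {S : DiscreteSpaces M} (hdiv : S.DivConforming) {τC : E d → ℝ}
    (hF : MemLp F 2 (volume.restrict Ω)) (hsol : IsOseenSolution Ω a ν F u p)
    (hu : MemHVec Ω 2 u) (hp : MemH Ω 1 p) {uh : E d → E d} {pt : E d → ℝ}
    (hred : IsReducedSolution S a ν τC τM F uh pt) (hv : v ∈ S.VhDivFree) (hq : q ∈ S.Qtot) :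
    formK Ω ν (v - uh) (v - uh) + stabPairing M τM (convField n Ω a (v - uh) (q - pt))
        (convField n Ω a (v - uh) (q - pt)) =
      stabPairing M τM (viscField M ν (v - uh)) (convField n Ω a (v - uh) (q - pt))
      - formC Ω a (u - v) (v - uh) - formK Ω ν (u - v) (v - uh)
      - stabPairing M τM (convField n Ω a (u - v) (p - q)) (convField n Ω a (v - uh) (q - pt))
      + stabPairing M τM (viscField M ν (u - v)) (convField n Ω a (v - uh) (q - pt)) := by
  have hΩ := M.isOpen
  have hw : v - uh ∈ S.VhDivFree := S.VhDivFree_sub_mem hv hred.1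
  have hwdiv := hdiv.mem_VDivFree hw
  have hr : q - pt ∈ S.Qtot := S.Qtot.sub_mem hq hred.2.1
  have hu1 := hu.of_le one_le_two
  have hv1 := VSpace.memHVec (S.Vh_subset v hv.1)
  have huh1 := VSpace.memHVec (S.Vh_subset uh hred.1.1)
  have hw1 := VSpace.memHVec (S.Vh_subset _ hw.1)
  have hq1 := S.memH_of_mem_Qtot hq
  have hpt1 := S.memH_of_mem_Qtot hred.2.1
  have hr1 := S.memH_of_mem_Qtot hr
  have hue : ∀ e, MemHVec (M.elem e) 2 u := fun e => hu.mono hΩ (M.elem_subset e)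
  have hve := S.Vh_regular v hv.1
  have huhe := S.Vh_regular uh hred.1.1
  set w := v - uh with hwdef
  set r := q - pt with hrdef
  have hB : ElemL2 M (convField n Ω a w r) := .convField hw1 hr1
  have e1 := hsol.galerkin hwdiv
  have e2 : formC Ω a uh w + formK Ω ν uh w +
      (stabPairing M τM (convField n Ω a uh pt) (convField n Ω a w r) -
        stabPairing M τM (viscField M ν uh) (convField n Ω a w r)) =
      innerL2 Ω F w + (stabPairing M τM (convField n Ω a u p) (convField n Ω a w r) -
        stabPairing M τM (viscField M ν u) (convField n Ω a w r)) := by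
    have e := hred.2.2 w hw r hr
    -- The discrete test velocity is exactly divergence-free, so the `τC` term drops out.
    have hC : ∫ x in Ω, τC x * divg Ω uh x * divg Ω w x = 0 := by
      rw [← integral_zero (E d) ℝ (μ := volume.restrict Ω)]
      refine integral_congr_ae ?_
      filter_upwards [hwdiv.2] with x hx
      rw [hx, mul_zero]
    rw [Ared, hC, add_zero] at e
    rw [← stabPairing_eq_sub (A := fun e i x => adv Ω a uh i x - viscDiv (M.elem e) ν uh i x +
        pd Ω i pt x) (.convField huh1 hpt1) (.viscField huhe) hB
        fun e => ae_of_all _ fun x i => by simp only [convField, viscField]; ring,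
      ← stabPairing_eq_sub (A := fun e i x => F x i) (.convField hu1 hp) (.viscField hue) hB ?_]
    · exact e
    · intro e
      -- Consistency: on each element the source equals the strong residual of the exact solution.
      filter_upwards [hsol.momentum hΩ (M.isOpen_elem e) (M.elem_subset e) hF hu hp] with x hx i
      rw [← hx i]
      simp only [convField, viscField]
      ring
  have c1 := formC_sub_left hΩ hu1 hv1 hw1 a
  have c2 := formC_sub_left hΩ hv1 huh1 hw1 a
  -- Skew-symmetry removes the convective form of the discrete error.
  have c3 : formC Ω a w w = 0 := by
    have := formC_antisymm hΩ hwdiv.1 hw1 a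
    linarith
  have k1 := formK_sub_left hΩ hu1 hv1 hw1 ν
  have k2 := formK_sub_left hΩ hv1 huh1 hw1 ν
  have s1 := stabPairing_eq_sub (τM := τM) (.convField hu1 hp) (.convField hv1 hq1) hB
    (convField_sub hu1 hv1 hp hq1 M a)
  have s2 := stabPairing_eq_sub (τM := τM) (.convField hv1 hq1) (.convField huh1 hpt1) hB
    (convField_sub hv1 huh1 hq1 hpt1 M a)
  have s3 := stabPairing_eq_sub (τM := τM) (.viscField hue) (.viscField hve) hB
    (viscField_sub hue hve ν)
  have s4 := stabPairing_eq_sub (τM := τM) (.viscField hve) (.viscField huhe) hB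
    (viscField_sub hve huhe ν)
  rw [← hwdef] at c2 k2 s2 s4
  rw [← hrdef] at s2
  linarith

end Pairing

/-! ### Estimates -/

section Estimates

variable {d n : ℕ} {Ω V : Set (E d)} {M : Mesh Ω n} {τM : Fin n → ℝ}
  {a : E d} {ν : ℝ} {v w : E d → E d} {q r : E d → ℝ}

theorem semiSqVec_nonneg (V : Set (E d)) (l : ℕ) (v : E d → E d) : 0 ≤ semiSqVec V l v :=
  Finset.sum_nonneg fun _ _ => semiSq_nonneg _ _ _

theorem semiSqVec_zero_order (hV : IsOpen V) (hv : ∀ i, MemLp (fun x => v x i) 2 (volume.restrict V)) :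
    semiSqVec V 0 v = ∫ x in V, ∑ i, v x i ^ 2 := by
  rw [integral_finsetSum _ fun i _ => (hv i).integrable_sq]
  exact Finset.sum_congr rfl fun i _ => semiSq_zero_order hV (hv i)

theorem integrable_sum_pd_sq (hV : IsOpen V) (hv : MemHVec V 1 v) :
    IntegrableOn (fun x => ∑ i, ∑ j, pd V j (fun y => v y i) x ^ 2) V :=
  integrable_finsetSum _ fun i _ => integrable_finsetSum _ fun j _ =>
    ((hv i).pd_memLp hV j).integrable_sq

theorem semiSqVec_one (hV : IsOpen V) (hv : MemHVec V 1 v) :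
    semiSqVec V 1 v = ∫ x in V, ∑ i, ∑ j, pd V j (fun y => v y i) x ^ 2 := by
  rw [integral_finsetSum _ fun i _ => integrable_finsetSum _ fun j _ =>
    ((hv i).pd_memLp hV j).integrable_sq]
  refine Finset.sum_congr rfl fun i _ => ?_
  rw [semiSq_one, integral_finsetSum _ fun j _ => ((hv i).pd_memLp hV j).integrable_sq]

theorem semiSqVec_one_elem (hv : MemHVec Ω 1 v) (e : Fin n) :
    semiSqVec (M.elem e) 1 v =
      ∫ x in M.elem e, ∑ i, ∑ j, pd Ω j (fun y => v y i) x ^ 2 := by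
  rw [semiSqVec_one (M.isOpen_elem e) (hv.mono M.isOpen (M.elem_subset e))]
  refine integral_congr_ae ?_
  filter_upwards [ae_forall_pd_comp_restrict M.isOpen (M.isOpen_elem e) (M.elem_subset e) hv]
    with x hx
  simp only [hx]

theorem semiSq_one_elem (hq : MemH Ω 1 q) (e : Fin n) :
    semiSq (M.elem e) 1 q = ∫ x in M.elem e, ∑ i, pd Ω i q x ^ 2 := by
  rw [semiSq_one, integral_finsetSum _ fun i _ =>
    ((hq.pd_memLp M.isOpen i).restrict_mono (M.elem_subset e)).integrable_sq]
  refine Finset.sum_congr rfl fun i _ => integral_congr_ae ?_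
  filter_upwards [pd_restrict M.isOpen (M.isOpen_elem e) (M.elem_subset e) hq i] with x hx
  rw [hx]

theorem semiSqVec_two (hV : IsOpen V) (hv : MemHVec V 2 v) :
    semiSqVec V 2 v =
      ∫ x in V, ∑ i, ∑ j, ∑ k, weakDeriv V ![j, k] (fun y => v y i) x ^ 2 := by
  have h : ∀ i j k, IntegrableOn (fun x => weakDeriv V ![j, k] (fun y => v y i) x ^ 2) V :=
    fun i j k => ((hv i).memLp_weakDeriv hV le_rfl _).integrable_sq
  rw [integral_finsetSum _ fun i _ => integrable_finsetSum _ fun j _ =>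
    integrable_finsetSum _ fun k _ => h i j k]
  refine Finset.sum_congr rfl fun i _ => ?_
  rw [semiSq_two, integral_finsetSum _ fun j _ => integrable_finsetSum _ fun k _ => h i j k]
  refine Finset.sum_congr rfl fun j _ => ?_
  rw [integral_finsetSum _ fun k _ => h i j k]

/-! ### Bounds of the forms by Sobolev seminorms -/

theorem sum_adv_sq_le (U : Set (E d)) (a : E d) (v : E d → E d) (x : E d) :
    ∑ i, adv U a v i x ^ 2 ≤ ‖a‖ ^ 2 * ∑ i, ∑ j, pd U j (fun y => v y i) x ^ 2 := by
  rw [Finset.mul_sum]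
  refine Finset.sum_le_sum fun i _ => ?_
  rw [EuclideanSpace.real_norm_sq_eq]
  exact Finset.sum_mul_sq_le_sq_mul_sq _ _ _

theorem sum_symGrad_sq_le (U : Set (E d)) (v : E d → E d) (x : E d) :
    ∑ i, ∑ j, symGrad U v i j x ^ 2 ≤ ∑ i, ∑ j, pd U j (fun y => v y i) x ^ 2 := by
  have h : ∀ i j, symGrad U v i j x ^ 2 ≤
      pd U j (fun y => v y i) x ^ 2 / 2 + pd U i (fun y => v y j) x ^ 2 / 2 := by
    intro i j
    unfold symGrad
    nlinarith [sq_nonneg (pd U j (fun y => v y i) x - pd U i (fun y => v y j) x)]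
  refine (Finset.sum_le_sum fun i _ => Finset.sum_le_sum fun j _ => h i j).trans (le_of_eq ?_)
  simp only [Finset.sum_add_distrib]
  rw [Finset.sum_comm (f := fun i j => pd U i (fun y => v y j) x ^ 2 / 2),
    ← Finset.sum_add_distrib]
  refine Finset.sum_congr rfl fun i _ => ?_
  rw [← Finset.sum_add_distrib]
  exact Finset.sum_congr rfl fun j _ => by ring

theorem integrable_sum_symGrad_sq (hV : IsOpen V) (hv : MemHVec V 1 v) :
    IntegrableOn (fun x => ∑ i, ∑ j, symGrad V v i j x ^ 2) V :=
  integrable_finsetSum _ fun i _ => integrable_finsetSum _ fun j _ =>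
    (memLp_symGrad hV hv i j).integrable_sq

theorem formK_self (V : Set (E d)) (ν : ℝ) (v : E d → E d) :
    formK V ν v v = 2 * ν * ∫ x in V, ∑ i, ∑ j, symGrad V v i j x ^ 2 := by
  rw [← integral_const_mul]
  unfold formK
  congr 1
  ext x
  simp only [Finset.mul_sum]
  exact Finset.sum_congr rfl fun i _ => Finset.sum_congr rfl fun j _ => by ring

theorem formK_self_nonneg (hν : 0 ≤ ν) (V : Set (E d)) (v : E d → E d) : 0 ≤ formK V ν v v := by
  rw [formK_self]
  exact mul_nonneg (by positivity) (integral_nonneg fun x => Finset.sum_nonneg fun i _ =>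
    Finset.sum_nonneg fun j _ => sq_nonneg _)

theorem abs_formK_le (hV : IsOpen V) (hν : 0 ≤ ν) (hv : MemHVec V 1 v) (hw : MemHVec V 1 w) :
    |formK V ν v w| ≤ formK V ν v v + 1 / 4 * formK V ν w w := by
  have iv := integrable_formK hV hv hv ν
  have iw := (integrable_formK hV hw hw ν).const_mul (1 / 4)
  unfold formK
  rw [← integral_const_mul, ← integral_add iv iw]
  refine abs_integral_le_integral_abs.trans
    (integral_mono (integrable_formK hV hv hw ν).abs (iv.add iw) fun x => ?_)
  beta_reduce
  rw [Finset.mul_sum, ← Finset.sum_add_distrib]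
  refine (Finset.abs_sum_le_sum_abs _ _).trans (Finset.sum_le_sum fun i _ => ?_)
  rw [Finset.mul_sum, ← Finset.sum_add_distrib]
  refine (Finset.abs_sum_le_sum_abs _ _).trans (Finset.sum_le_sum fun j _ => ?_)
  rw [mul_assoc, abs_mul, abs_of_nonneg (by positivity : 0 ≤ 2 * ν)]
  refine (mul_le_mul_of_nonneg_left (abs_mul_le_young one_pos _ _) (by positivity)).trans
    (le_of_eq ?_)
  ring

theorem formK_self_le (hν : 0 ≤ ν) (hv : MemHVec Ω 1 v) :
    formK Ω ν v v ≤ 2 * ν * ∑ e, semiSqVec (M.elem e) 1 v := by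
  simp only [semiSqVec_one_elem hv]
  rw [← M.setIntegral_eq_sum (integrable_sum_pd_sq M.isOpen hv), formK_self]
  exact mul_le_mul_of_nonneg_left (integral_mono (integrable_sum_symGrad_sq M.isOpen hv)
    (integrable_sum_pd_sq M.isOpen hv) fun x => sum_symGrad_sq_le Ω v x) (by positivity)

/-- The inverse estimate controls the viscous part of the stabilization. -/
theorem stabPairing_viscField_le_formK {S : DiscreteSpaces M} {Cinv : ℝ} (hν : 0 < ν)
    (hC : 0 < Cinv) (hinv : S.InverseEstimate ν Cinv) (hh : ∀ e, 0 < M.he e)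
    (hτ : ∀ e, τM e ≤ M.he e ^ 2 / (Cinv * ν)) (hw : w ∈ S.Vh) :
    stabPairing M τM (viscField M ν w) (viscField M ν w) ≤ 1 / 2 * formK Ω ν w w := by
  have hw1 := VSpace.memHVec (S.Vh_subset w hw)
  rw [stabPairing_self, formK_self, M.setIntegral_eq_sum (integrable_sum_symGrad_sq M.isOpen hw1),
    Finset.mul_sum, Finset.mul_sum]
  refine Finset.sum_le_sum fun e _ => ?_
  have h1 := hinv e w hw
  have h2 : ∫ x in M.elem e, ∑ i, ∑ j, (ν * symGrad (M.elem e) w i j x) ^ 2 =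
      ν ^ 2 * ∫ x in M.elem e, ∑ i, ∑ j, symGrad Ω w i j x ^ 2 := by
    rw [← integral_const_mul]
    refine integral_congr_ae ?_
    filter_upwards [symGrad_restrict M.isOpen (M.isOpen_elem e) (M.elem_subset e) hw1] with x hx
    simp only [hx, mul_pow, Finset.mul_sum]
  set I := ∫ x in M.elem e, ∑ i, ∑ j, symGrad Ω w i j x ^ 2 with hI
  have hI0 : 0 ≤ I := integral_nonneg fun x => Finset.sum_nonneg fun i _ =>
    Finset.sum_nonneg fun j _ => sq_nonneg _
  rw [h2] at h1
  have he := hh e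
  -- The factors `h_e²` and `Cinv` of the inverse estimate cancel against the bound of `τM`, leaving
  -- half of the elementwise viscous energy.
  calc τM e * ∫ x in M.elem e, ∑ i, viscField M ν w e i x ^ 2
      ≤ M.he e ^ 2 / (Cinv * ν) * (Cinv / M.he e ^ 2 * (ν ^ 2 * I)) :=
        mul_le_mul (hτ e) h1 (integral_nonneg fun x => Finset.sum_nonneg fun i _ => sq_nonneg _)
          (by positivity)
    _ = 1 / 2 * (2 * ν * I) := by field_simp

theorem stabPairing_convField_le (hτ : ∀ e, 0 ≤ τM e) (hv : MemHVec Ω 1 v) (hq : MemH Ω 1 q) :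
    stabPairing M τM (convField n Ω a v q) (convField n Ω a v q) ≤
      ∑ e, τM e * (2 * ‖a‖ ^ 2 * semiSqVec (M.elem e) 1 v + 2 * semiSq (M.elem e) 1 q) := by
  rw [stabPairing_self]
  refine Finset.sum_le_sum fun e _ => mul_le_mul_of_nonneg_left ?_ (hτ e)
  have i1 : IntegrableOn (fun x => 2 * ‖a‖ ^ 2 * ∑ i, ∑ j, pd Ω j (fun y => v y i) x ^ 2)
      (M.elem e) :=
    ((integrable_sum_pd_sq M.isOpen hv).mono_set (M.elem_subset e)).const_mul _
  have i2 : IntegrableOn (fun x => 2 * ∑ i, pd Ω i q x ^ 2) (M.elem e) :=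
    (integrable_finsetSum _ fun i _ => ((hq.pd_memLp M.isOpen i).restrict_mono
      (M.elem_subset e)).integrable_sq).const_mul _
  rw [semiSqVec_one_elem hv, semiSq_one_elem hq, ← integral_const_mul, ← integral_const_mul,
    ← integral_add i1 i2]
  refine integral_mono (integrable_finsetSum _ fun i _ =>
    (ElemL2.convField hv hq e i).integrable_sq) (i1.add i2) fun x => ?_
  beta_reduce
  have h1 := sum_adv_sq_le Ω a v x
  have h2 : ∑ i, convField n Ω a v q e i x ^ 2 ≤
      2 * ∑ i, adv Ω a v i x ^ 2 + 2 * ∑ i, pd Ω i q x ^ 2 := by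
    rw [Finset.mul_sum, Finset.mul_sum, ← Finset.sum_add_distrib]
    refine Finset.sum_le_sum fun i _ => ?_
    simp only [convField]
    nlinarith [sq_nonneg (adv Ω a v i x - pd Ω i q x)]
  linarith

/-- Each component is `ν` times a sum of `d` pairs of second derivatives. Cauchy–Schwarz over the
sum gives the factor `d`; the two families of a pair give the `4`. -/
theorem integral_viscDiv_sq_le (hV : IsOpen V) (hv : MemHVec V 2 v) (ν : ℝ) :
    ∫ x in V, ∑ i, viscDiv V ν v i x ^ 2 ≤ 4 * ν ^ 2 * d * semiSqVec V 2 v := by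
  rw [semiSqVec_two hV hv, ← integral_const_mul]
  refine integral_mono_ae (integrable_finsetSum _ fun i _ =>
    (memLp_viscDiv hV hv ν i).integrable_sq) (Integrable.const_mul (integrable_finsetSum _
      fun i _ => integrable_finsetSum _ fun j _ => integrable_finsetSum _ fun k _ =>
        ((hv i).memLp_weakDeriv hV le_rfl _).integrable_sq) _) ?_
  filter_upwards [viscDiv_ae_eq hV hv ν] with x hx
  set D : Fin d → Fin d → Fin d → ℝ := fun i j k => weakDeriv V ![j, k] (fun y => v y i) x with hD
  have h1 : ∀ i, viscDiv V ν v i x ^ 2 ≤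
      2 * ν ^ 2 * d * (∑ j, D i j j ^ 2 + ∑ j, D j i j ^ 2) := by
    intro i
    have hsq := Finset.sum_mul_sq_le_sq_mul_sq Finset.univ (fun _ : Fin d => (1 : ℝ))
      (fun j => D i j j + D j i j)
    simp only [one_mul, one_pow, Finset.sum_const, Finset.card_univ, Fintype.card_fin,
      nsmul_eq_mul, mul_one] at hsq
    have h3 : ∑ j, (D i j j + D j i j) ^ 2 ≤ 2 * (∑ j, D i j j ^ 2 + ∑ j, D j i j ^ 2) := by
      rw [← Finset.sum_add_distrib, Finset.mul_sum]
      exact Finset.sum_le_sum fun j _ => by nlinarith [sq_nonneg (D i j j - D j i j)]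
    rw [hx i, mul_pow]
    calc ν ^ 2 * (∑ j, (D i j j + D j i j)) ^ 2
        ≤ ν ^ 2 * (d * (2 * (∑ j, D i j j ^ 2 + ∑ j, D j i j ^ 2))) :=
          mul_le_mul_of_nonneg_left
            (hsq.trans (mul_le_mul_of_nonneg_left h3 (Nat.cast_nonneg d))) (sq_nonneg ν)
      _ = _ := by ring
  have h2 : ∑ i, ∑ j, D i j j ^ 2 ≤ ∑ i, ∑ j, ∑ k, D i j k ^ 2 :=
    Finset.sum_le_sum fun i _ => Finset.sum_le_sum fun j _ =>
      Finset.single_le_sum (f := fun k => D i j k ^ 2) (fun _ _ => sq_nonneg _) (Finset.mem_univ j)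
  have h3 : ∑ i, ∑ j, D j i j ^ 2 ≤ ∑ i, ∑ j, ∑ k, D i j k ^ 2 := by
    rw [Finset.sum_comm]
    exact Finset.sum_le_sum fun j _ => Finset.sum_le_sum fun i _ =>
      Finset.single_le_sum (f := fun k => D j i k ^ 2) (fun _ _ => sq_nonneg _) (Finset.mem_univ j)
  refine (Finset.sum_le_sum fun i _ => h1 i).trans ?_
  rw [← Finset.mul_sum, Finset.sum_add_distrib]
  have h4 : 0 ≤ 2 * ν ^ 2 * (d : ℝ) := by positivity
  calc _ ≤ 2 * ν ^ 2 * d * (∑ i, ∑ j, ∑ k, D i j k ^ 2 + ∑ i, ∑ j, ∑ k, D i j k ^ 2) :=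
        mul_le_mul_of_nonneg_left (add_le_add h2 h3) h4
    _ = _ := by ring

theorem stabPairing_viscField_le (hτ : ∀ e, 0 ≤ τM e) (hv : ∀ e, MemHVec (M.elem e) 2 v) (ν : ℝ) :
    stabPairing M τM (viscField M ν v) (viscField M ν v) ≤
      ∑ e, τM e * (4 * ν ^ 2 * d * semiSqVec (M.elem e) 2 v) := by
  rw [stabPairing_self]
  exact Finset.sum_le_sum fun e _ => mul_le_mul_of_nonneg_left
    (integral_viscDiv_sq_le (M.isOpen_elem e) (hv e) ν) (hτ e)

/-- Bound of the convective form by the stabilization. -/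
theorem abs_formC_le_stabPairing (hτ : ∀ e, 0 < τM e) (hv : v ∈ VDivFree Ω)
    (hw : MemHVec Ω 1 w) (hr : MemH Ω 1 r) (a : E d) :
    |formC Ω a v w| ≤ 2 * (∑ e, (τM e)⁻¹ * semiSqVec (M.elem e) 0 v) +
      1 / 8 * stabPairing M τM (convField n Ω a w r) (convField n Ω a w r) := by
  have hΩ := M.isOpen
  have hv1 := VSpace.memHVec hv.1
  have hvL : ∀ e i, MemLp (fun x => v x i) 2 (volume.restrict (M.elem e)) :=
    fun e i => (hv1 i).1.restrict_mono (M.elem_subset e)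
  -- The factor `τM⁻¹` cancels the weight of the pairing, so that pairing with `A` is the plain `L²`
  -- inner product with `v`.
  set A : Fin n → Fin d → E d → ℝ := fun e i x => (τM e)⁻¹ * v x i with hA
  have hA2 : ElemL2 M A := fun e i => (hvL e i).const_mul _
  have h1 : formC Ω a v w = -stabPairing M τM A (convField n Ω a w r) := by
    have i1 : IntegrableOn (fun x => ∑ i, pd Ω i r x * v x i) Ω :=
      integrable_sum_mul (fun i => hr.pd_memLp hΩ i) fun i => (hv1 i).1
    have i2 := integrable_formC hΩ hw hv1 a
    have i3 : IntegrableOn (fun x => ∑ i, adv Ω a w i x * v x i + ∑ i, pd Ω i r x * v x i) Ω :=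
      i2.add i1
    -- Move the derivative onto `w`, then insert `∇ r`, which is orthogonal to the divergence-free
    -- `v`.
    rw [formC_antisymm hΩ hv.1 hw a, formC, ← add_zero (integral _ _),
      ← integral_grad_mul_eq_zero hΩ hv hr, ← integral_add i2 i1, M.setIntegral_eq_sum i3]
    congr 1
    refine Finset.sum_congr rfl fun e _ => ?_
    congr 1
    ext x
    rw [← Finset.sum_add_distrib]
    refine Finset.sum_congr rfl fun i _ => ?_
    have := (hτ e).ne'
    simp only [hA, convField]
    field_simp
  have h2 : stabPairing M τM A A = ∑ e, (τM e)⁻¹ * semiSqVec (M.elem e) 0 v := by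
    rw [stabPairing_self]
    refine Finset.sum_congr rfl fun e _ => ?_
    rw [semiSqVec_zero_order (M.isOpen_elem e) (hvL e), ← integral_const_mul,
      ← integral_const_mul]
    congr 1
    ext x
    rw [Finset.mul_sum, Finset.mul_sum]
    refine Finset.sum_congr rfl fun i _ => ?_
    have := (hτ e).ne'
    simp only [hA]
    field_simp
  rw [h1, abs_neg, ← h2]
  refine (abs_stabPairing_le (fun e => (hτ e).le) hA2 (.convField hw hr) two_pos).trans
    (le_of_eq ?_)
  norm_num

/-- Bound of the convective form by the viscous form. -/
theorem abs_formC_le_formK (hν : 0 < ν) (ha : a ≠ 0) (hv : v ∈ VDivFree Ω) (hw : MemHVec Ω 1 w) :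
    |formC Ω a v w| ≤ 1 / 4 * formK Ω ν w w +
      2 * ‖a‖ ^ 2 / ν * ∑ e, semiSqVec (M.elem e) 0 v := by
  have hΩ := M.isOpen
  have hv1 := VSpace.memHVec hv.1
  have ha' : 0 < ‖a‖ := norm_pos_iff.2 ha
  have i1 : IntegrableOn (fun x => ν / 2 * ∑ i, ∑ j, symGrad Ω w i j x ^ 2) Ω :=
    (integrable_sum_symGrad_sq hΩ hw).const_mul _
  have i0 : IntegrableOn (fun x => ∑ i, v x i ^ 2) Ω :=
    integrable_finsetSum _ fun i _ => (hv1 i).1.integrable_sq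
  have i2 : IntegrableOn (fun x => 2 * ‖a‖ ^ 2 / ν * ∑ i, v x i ^ 2) Ω := i0.const_mul _
  have h0 : ∑ e, semiSqVec (M.elem e) 0 v = ∫ x in Ω, ∑ i, v x i ^ 2 := by
    rw [M.setIntegral_eq_sum i0]
    exact Finset.sum_congr rfl fun e _ => semiSqVec_zero_order (M.isOpen_elem e)
      fun i => (hv1 i).1.restrict_mono (M.elem_subset e)
  have hK : 1 / 4 * formK Ω ν w w = ν / 2 * ∫ x in Ω, ∑ i, ∑ j, symGrad Ω w i j x ^ 2 := by
    rw [formK_self]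
    ring
  have hsg : ∀ i, MemLp (fun x => ∑ j, 2 * a j * symGrad Ω w i j x) 2 (volume.restrict Ω) :=
    fun i => memLp_finsetSum _ fun j _ => (memLp_symGrad hΩ hw i j).const_mul _
  rw [formC_antisymm hΩ hv.1 hw a, abs_neg, formC_eq_integral_symGrad hΩ hw hv, h0, hK,
    ← integral_const_mul, ← integral_const_mul, ← integral_add i1 i2]
  refine abs_integral_le_integral_abs.trans (integral_mono
    (integrable_sum_mul hsg fun i => (hv1 i).1).abs (i1.add i2) fun x => ?_)
  beta_reduce
  rw [Finset.mul_sum, Finset.mul_sum, ← Finset.sum_add_distrib]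
  refine (Finset.abs_sum_le_sum_abs _ _).trans (Finset.sum_le_sum fun i _ => ?_)
  have hs : (∑ j, 2 * a j * symGrad Ω w i j x) ^ 2 ≤
      4 * ‖a‖ ^ 2 * ∑ j, symGrad Ω w i j x ^ 2 := by
    have := Finset.sum_mul_sq_le_sq_mul_sq Finset.univ (fun j => a j)
      (fun j => symGrad Ω w i j x)
    rw [← EuclideanSpace.real_norm_sq_eq] at this
    simp only [mul_assoc, ← Finset.mul_sum]
    nlinarith
  -- This weight turns the factor `4 ‖a‖²` of `hs` into `ν / 2`, the coefficient of a quarter of the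
  -- viscous form.
  have hδ : 0 < ν / (8 * ‖a‖ ^ 2) := by positivity
  refine (abs_mul_le_young hδ _ _).trans ?_
  have e1 : 1 / (4 * (ν / (8 * ‖a‖ ^ 2))) = 2 * ‖a‖ ^ 2 / ν := by
    field_simp
    norm_num
  rw [e1]
  refine add_le_add ((mul_le_mul_of_nonneg_left hs hδ.le).trans (le_of_eq ?_)) le_rfl
  field_simp
  ring

end Estimates

/-! ### The error estimate -/

section Rates

variable {d n : ℕ} {Ω : Set (E d)} {M : Mesh Ω n} {τM : Fin n → ℝ} {f : ℝ → ℝ} {Cinv Cqu : ℝ}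
  {a : E d} {ν : ℝ} {u v w : E d → E d} {p q r : E d → ℝ}

/-! ### Bounds of the stabilization parameter -/

theorem StabilizationParameter.pos (h : StabilizationParameter M a ν f τM)
    (hf_pos : ∀ γ > 0, 0 < f γ) (hh : ∀ e, 0 < M.he e) (ha : a ≠ 0) (hν : 0 < ν) (e : Fin n) :
    0 < τM e := by
  have ha' : 0 < ‖a‖ := norm_pos_iff.2 ha
  have he := hh e
  rw [h e]
  exact mul_pos (by positivity) (hf_pos _ (by positivity))

theorem StabilizationParameter.le_diffusive (h : StabilizationParameter M a ν f τM)
    (hf_le : ∀ γ > 0, f γ ≤ min 1 (4 * γ / Cinv)) (hh : ∀ e, 0 < M.he e) (ha : a ≠ 0)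
    (hν : 0 < ν) (e : Fin n) : τM e ≤ M.he e ^ 2 / (Cinv * ν) := by
  have ha' : 0 < ‖a‖ := norm_pos_iff.2 ha
  have he := hh e
  rw [h e]
  refine (mul_le_mul_of_nonneg_left ((hf_le _ (by positivity)).trans (min_le_right _ _))
    (by positivity)).trans (le_of_eq ?_)
  field_simp
  ring

theorem StabilizationParameter.le_convective (h : StabilizationParameter M a ν f τM)
    (hf_le : ∀ γ > 0, f γ ≤ min 1 (4 * γ / Cinv)) (hh : ∀ e, 0 < M.he e) (ha : a ≠ 0)
    (hν : 0 < ν) (e : Fin n) : τM e ≤ M.he e / (2 * ‖a‖) := by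
  have ha' : 0 < ‖a‖ := norm_pos_iff.2 ha
  have he := hh e
  rw [h e]
  exact (mul_le_mul_of_nonneg_left ((hf_le _ (by positivity)).trans (min_le_left _ _))
    (by positivity)).trans (le_of_eq (mul_one _))

/-- In the convection-dominated case `τ_M` is bounded below by a multiple of `h / |a|`. -/
theorem StabilizationParameter.inv_le (h : StabilizationParameter M a ν f τM)
    (hf_mono : MonotoneOn f (Ioi 0)) (hf_pos : ∀ γ > 0, 0 < f γ) (hh : ∀ e, 0 < M.he e)
    (ha : a ≠ 0) (hν : 0 < ν) {κ : ℝ} (hκ : 0 < κ) (hq : ∀ e, M.h ≤ κ * M.he e)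
    (hdom : ν ≤ ‖a‖ * M.h) (e : Fin n) :
    (τM e)⁻¹ ≤ 2 * κ / f (1 / (2 * κ)) * (‖a‖ / M.h) := by
  have ha' : 0 < ‖a‖ := norm_pos_iff.2 ha
  have he := hh e
  have hh' : 0 < M.h := he.trans_le (M.he_le_h e)
  have hm : 0 < f (1 / (2 * κ)) := hf_pos _ (by positivity)
  -- Quasi-uniformity and `ν ≤ ‖a‖ h` keep every element Péclet number above `1 / (2 κ)`, so
  -- monotonicity bounds `f` below by a number depending only on `f` and `κ`.
  have hγ : 1 / (2 * κ) ≤ ‖a‖ * M.he e / (2 * ν) := by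
    rw [div_le_div_iff₀ (by positivity) (by positivity)]
    nlinarith [mul_le_mul_of_nonneg_left (hq e) ha'.le]
  have hf := hf_mono (show 1 / (2 * κ) ∈ Ioi (0 : ℝ) from by simp [hκ])
    (show ‖a‖ * M.he e / (2 * ν) ∈ Ioi (0 : ℝ) from by simp only [mem_Ioi]; positivity) hγ
  have hlow : M.h / κ / (2 * ‖a‖) * f (1 / (2 * κ)) ≤ τM e := by
    rw [h e]
    have : M.h / κ ≤ M.he e := by
      rw [div_le_iff₀ hκ, mul_comm]
      exact hq e
    gcongr
  calc (τM e)⁻¹ ≤ (M.h / κ / (2 * ‖a‖) * f (1 / (2 * κ)))⁻¹ := inv_anti₀ (by positivity) hlow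
    _ = _ := by field_simp

/-- Each regime uses the bound suited to it: the stabilization when convection dominates, the
viscous form when diffusion does. Adding the two right-hand sides gives one estimate without a case
distinction. -/
theorem abs_formC_le_of_interpolation (h : StabilizationParameter M a ν f τM)
    (hf_mono : MonotoneOn f (Ioi 0)) (hf_pos : ∀ γ > 0, 0 < f γ) (hh : ∀ e, 0 < M.he e)
    (ha : a ≠ 0) (hν : 0 < ν) (hpos : 0 < M.h) {κ : ℝ} (hκ : 0 < κ)
    (hq : ∀ e, M.h ≤ κ * M.he e) (hv : v ∈ VDivFree Ω) (hw : MemHVec Ω 1 w) (hr : MemH Ω 1 r)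
    {X : ℝ} (hX : 0 ≤ X) (hN : ∑ e, semiSqVec (M.elem e) 0 v ≤ M.h ^ 2 * X) :
    |formC Ω a v w| ≤ 1 / 4 * formK Ω ν w w +
      1 / 8 * stabPairing M τM (convField n Ω a w r) (convField n Ω a w r) +
      (4 * κ / f (1 / (2 * κ)) + 2) * (max (‖a‖ * M.h) ν * X) := by
  have ha' : 0 < ‖a‖ := norm_pos_iff.2 ha
  have hm : 0 < f (1 / (2 * κ)) := hf_pos _ (by positivity)
  have hτ := h.pos hf_pos hh ha hν
  have hK := formK_self_nonneg hν.le Ω w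
  have hT := stabPairing_self_nonneg (M := M) (fun e => (hτ e).le) (convField n Ω a w r)
  have hHX : 0 ≤ max (‖a‖ * M.h) ν * X := mul_nonneg (le_max_of_le_right hν.le) hX
  have hc : 0 ≤ 4 * κ / f (1 / (2 * κ)) := by positivity
  rcases le_total ν (‖a‖ * M.h) with hdom | hdom
  · have h1 := abs_formC_le_stabPairing (M := M) hτ hv hw hr a
    have h2 : ∑ e, (τM e)⁻¹ * semiSqVec (M.elem e) 0 v ≤
        2 * κ / f (1 / (2 * κ)) * (max (‖a‖ * M.h) ν * X) := by
      calc ∑ e, (τM e)⁻¹ * semiSqVec (M.elem e) 0 v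
          ≤ ∑ e, 2 * κ / f (1 / (2 * κ)) * (‖a‖ / M.h) * semiSqVec (M.elem e) 0 v :=
            Finset.sum_le_sum fun e _ => mul_le_mul_of_nonneg_right
              (h.inv_le hf_mono hf_pos hh ha hν hκ hq hdom e) (semiSqVec_nonneg _ _ _)
        _ ≤ 2 * κ / f (1 / (2 * κ)) * (‖a‖ / M.h) * (M.h ^ 2 * X) := by
            rw [← Finset.mul_sum]
            exact mul_le_mul_of_nonneg_left hN (by positivity)
        _ = 2 * κ / f (1 / (2 * κ)) * (‖a‖ * M.h * X) := by field_simp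
        _ ≤ _ := by
            gcongr
            exact le_max_left _ _
    have h3 : 2 * (2 * κ / f (1 / (2 * κ)) * (max (‖a‖ * M.h) ν * X)) =
        4 * κ / f (1 / (2 * κ)) * (max (‖a‖ * M.h) ν * X) := by ring
    nlinarith
  · have h1 := abs_formC_le_formK (M := M) hν ha hv hw
    have h2 : 2 * ‖a‖ ^ 2 / ν * ∑ e, semiSqVec (M.elem e) 0 v ≤
        2 * (max (‖a‖ * M.h) ν * X) := by
      calc 2 * ‖a‖ ^ 2 / ν * ∑ e, semiSqVec (M.elem e) 0 v
          ≤ 2 * ‖a‖ ^ 2 / ν * (M.h ^ 2 * X) := mul_le_mul_of_nonneg_left hN (by positivity)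
        _ = 2 * ((‖a‖ * M.h) ^ 2 / ν * X) := by ring
        _ ≤ 2 * (ν * X) := by
            have : (‖a‖ * M.h) ^ 2 / ν ≤ ν := by
              rw [div_le_iff₀ hν, ← sq]
              gcongr
            gcongr
        _ ≤ _ := by
            gcongr
            exact le_max_right _ _
    nlinarith [mul_nonneg hc hHX]

/-- Split one argument of the squared norm and apply Young to each piece; half of the left-hand side
is absorbed. Only linearity in the first argument is needed. -/
theorem tripleNormSq_sub_le {v' v'' : E d → E d} {q' q'' : E d → ℝ} (hν : 0 ≤ ν)
    (hτ : ∀ e, 0 ≤ τM e) (hv : MemHVec Ω 1 v) (hv' : MemHVec Ω 1 v') (hv'' : MemHVec Ω 1 v'')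
    (hq : MemH Ω 1 q) (hq' : MemH Ω 1 q') (hq'' : MemH Ω 1 q'') :
    tripleNormSq M a ν τM (v - v'') (q - q'') ≤
      2 * tripleNormSq M a ν τM (v - v') (q - q') +
        2 * tripleNormSq M a ν τM (v' - v'') (q' - q'') := by
  have hΩ := M.isOpen
  have he := hv.sub hΩ hv''
  have hB : ElemL2 M (convField n Ω a (v - v'') (q - q'')) := .convField he (hq.sub hΩ hq'')
  have hB1 : ElemL2 M (convField n Ω a (v - v') (q - q')) :=
    .convField (hv.sub hΩ hv') (hq.sub hΩ hq')
  have hB2 : ElemL2 M (convField n Ω a (v' - v'') (q' - q'')) :=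
    .convField (hv'.sub hΩ hv'') (hq'.sub hΩ hq'')
  have k1 := formK_sub_left hΩ hv hv'' he ν
  have k2 := formK_sub_left hΩ hv hv' he ν
  have k3 := formK_sub_left hΩ hv' hv'' he ν
  have s1 := stabPairing_eq_sub (τM := τM) (.convField hv hq) (.convField hv'' hq'') hB
    (convField_sub hv hv'' hq hq'' M a)
  have s2 := stabPairing_eq_sub (τM := τM) (.convField hv hq) (.convField hv' hq') hB
    (convField_sub hv hv' hq hq' M a)
  have s3 := stabPairing_eq_sub (τM := τM) (.convField hv' hq') (.convField hv'' hq'') hB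
    (convField_sub hv' hv'' hq' hq'' M a)
  have a1 := (le_abs_self _).trans (abs_formK_le hΩ hν (hv.sub hΩ hv') he)
  have a2 := (le_abs_self _).trans (abs_formK_le hΩ hν (hv'.sub hΩ hv'') he)
  have b1 := (le_abs_self _).trans (abs_stabPairing_le hτ hB1 hB one_pos)
  have b2 := (le_abs_self _).trans (abs_stabPairing_le hτ hB2 hB one_pos)
  simp only [tripleNormSq_eq]
  linarith

/-- A priori bound of the error in terms of the approximation error of a discrete pair `(v, q)`,
whose seminorms are controlled by `X` and `Y`. -/
theorem tripleNormSq_error_le {S : DiscreteSpaces M} (hbd : Bornology.IsBounded Ω)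
    (hne : Ω.Nonempty) (hCinv : 0 < Cinv) (hf_mono : MonotoneOn f (Ioi 0))
    (hf_pos : ∀ γ > 0, 0 < f γ) (hf_le : ∀ γ > 0, f γ ≤ min 1 (4 * γ / Cinv)) {κ : ℝ}
    (hκ : 0 < κ) (hqu : M.QuasiUniform κ) (ha : a ≠ 0) (hν : 0 < ν) {τC : E d → ℝ}
    (hinv : S.InverseEstimate ν Cinv) (hdiv : S.DivConforming)
    (hstab : StabilizationParameter M a ν f τM) {F : E d → E d}
    (hF : MemLp F 2 (volume.restrict Ω)) (hsol : IsOseenSolution Ω a ν F u p)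
    (hu : MemHVec Ω 2 u) (hp : MemH Ω 1 p) {uh : E d → E d} {pt : E d → ℝ}
    (hred : IsReducedSolution S a ν τC τM F uh pt) (hv : v ∈ S.VhDivFree) (hq : q ∈ S.Qtot)
    {X Y : ℝ} (hX : 0 ≤ X) (hY : 0 ≤ Y)
    (h0 : ∑ e, semiSqVec (M.elem e) 0 (u - v) ≤ M.h ^ 2 * X)
    (h1 : ∑ e, semiSqVec (M.elem e) 1 (u - v) ≤ X)
    (h2 : M.h ^ 2 * ∑ e, semiSqVec (M.elem e) 2 (u - v) ≤ X)
    (h3 : M.h ^ 2 * ∑ e, semiSq (M.elem e) 1 (p - q) ≤ Y) :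
    tripleNormSq M a ν τM (u - uh) (p - pt) ≤
      18 * ((4 * κ / f (1 / (2 * κ)) + 6 + 8 * d / Cinv) * (max (‖a‖ * M.h) ν * X) +
        4 * (1 / 2 + 1 / Cinv) * ((max (‖a‖ * M.h) ν)⁻¹ * Y)) := by
  have hΩ := M.isOpen
  have ha' : 0 < ‖a‖ := norm_pos_iff.2 ha
  have hh := M.he_pos hbd ha
  have hhq := hqu.h_le hne
  have hpos : 0 < M.h := by
    obtain ⟨e⟩ := M.nonempty_index hne
    exact (hh e).trans_le (M.he_le_h e)
  have hτ := hstab.pos hf_pos hh ha hν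
  have hτ0 : ∀ e, 0 ≤ τM e := fun e => (hτ e).le
  have hτd := hstab.le_diffusive hf_le hh ha hν
  have hτc := hstab.le_convective hf_le hh ha hν
  set H := max (‖a‖ * M.h) ν with hH
  have hHν : ν ≤ H := le_max_right _ _
  have hHa : ‖a‖ * M.h ≤ H := le_max_left _ _
  have hHpos : 0 < H := hν.trans_le hHν
  have hu1 := hu.of_le one_le_two
  have hv1 := VSpace.memHVec (S.Vh_subset v hv.1)
  have huh1 := VSpace.memHVec (S.Vh_subset uh hred.1.1)
  have hq1 := S.memH_of_mem_Qtot hq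
  have hpt1 := S.memH_of_mem_Qtot hred.2.1
  have hη := hu1.sub hΩ hv1
  have hψ := hp.sub hΩ hq1
  have hηe : ∀ e, MemHVec (M.elem e) 2 (u - v) := fun e =>
    (hu.mono hΩ (M.elem_subset e)).sub (M.isOpen_elem e) (S.Vh_regular v hv.1 e)
  have hηdiv := VDivFree.sub_mem hΩ (hsol.mem_VDivFree hΩ hbd) (hdiv.mem_VDivFree hv)
  have hwmem : v - uh ∈ S.VhDivFree := S.VhDivFree_sub_mem hv hred.1
  have hw := hv1.sub hΩ huh1
  have hr := hq1.sub hΩ hpt1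
  have hB : ElemL2 M (convField n Ω a (v - uh) (q - pt)) := .convField hw hr
  -- the bounds of the parameter
  have t1 : ∀ e, τM e * (2 * ‖a‖ ^ 2) ≤ H := by
    intro e
    calc τM e * (2 * ‖a‖ ^ 2) ≤ M.he e / (2 * ‖a‖) * (2 * ‖a‖ ^ 2) := by gcongr; exact hτc e
      _ = ‖a‖ * M.he e := by field_simp
      _ ≤ ‖a‖ * M.h := by gcongr; exact M.he_le_h e
      _ ≤ H := hHa
  have td : ∀ e, τM e * ν ≤ 1 / Cinv * M.h ^ 2 := by
    intro e
    have := hh e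
    calc τM e * ν ≤ M.he e ^ 2 / (Cinv * ν) * ν := by gcongr; exact hτd e
      _ = 1 / Cinv * M.he e ^ 2 := by field_simp
      _ ≤ _ := by gcongr; exact M.he_le_h e
  have tc : ∀ e, τM e * (‖a‖ * M.h) ≤ 1 / 2 * M.h ^ 2 := by
    intro e
    calc τM e * (‖a‖ * M.h) ≤ M.he e / (2 * ‖a‖) * (‖a‖ * M.h) := by gcongr; exact hτc e
      _ = 1 / 2 * (M.he e * M.h) := by field_simp
      _ ≤ 1 / 2 * (M.h * M.h) := by gcongr; exact M.he_le_h e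
      _ = _ := by ring
  -- The convective bound of `τM` serves when the maximum `H` is `‖a‖ h`, the diffusive one when it
  -- is `ν`; adding their constants covers both.
  have t2 : ∀ e, τM e * 2 ≤ 2 * (1 / 2 + 1 / Cinv) * H⁻¹ * M.h ^ 2 := by
    intro e
    have hsum : τM e * H ≤ (1 / 2 + 1 / Cinv) * M.h ^ 2 := by
      have hc : 0 ≤ 1 / Cinv * M.h ^ 2 := by positivity
      have hc' : 0 ≤ 1 / 2 * M.h ^ 2 := by positivity
      rw [hH]
      rcases max_cases (‖a‖ * M.h) ν with hm | hm
      · rw [hm.1]; linarith [tc e]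
      · rw [hm.1]; linarith [td e]
    calc τM e * 2 = 2 * (τM e * H) * H⁻¹ := by field_simp
      _ ≤ 2 * ((1 / 2 + 1 / Cinv) * M.h ^ 2) * H⁻¹ := by gcongr
      _ = _ := by ring
  have t3 : ∀ e, τM e * (4 * ν ^ 2 * d) ≤ 4 * d / Cinv * H * M.h ^ 2 := by
    intro e
    calc τM e * (4 * ν ^ 2 * d) = 4 * d * (τM e * ν) * ν := by ring
      _ ≤ 4 * d * (1 / Cinv * M.h ^ 2) * H := by
          refine mul_le_mul (mul_le_mul_of_nonneg_left (td e) (by positivity)) hHν hν.le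
            (by positivity)
      _ = _ := by ring
  -- the approximation error
  have eK : formK Ω ν (u - v) (u - v) ≤ 2 * (H * X) := by
    calc formK Ω ν (u - v) (u - v) ≤ 2 * ν * ∑ e, semiSqVec (M.elem e) 1 (u - v) :=
          formK_self_le hν.le hη
      _ ≤ 2 * H * X := by
          refine mul_le_mul (by linarith) h1 ?_ (by positivity)
          exact Finset.sum_nonneg fun e _ => semiSqVec_nonneg _ _ _
      _ = _ := by ring
  have eT : stabPairing M τM (convField n Ω a (u - v) (p - q)) (convField n Ω a (u - v) (p - q)) ≤
      H * X + 2 * (1 / 2 + 1 / Cinv) * (H⁻¹ * Y) := by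
    refine (stabPairing_convField_le hτ0 hη hψ).trans ?_
    calc ∑ e, τM e * (2 * ‖a‖ ^ 2 * semiSqVec (M.elem e) 1 (u - v) +
          2 * semiSq (M.elem e) 1 (p - q))
        ≤ ∑ e, (H * semiSqVec (M.elem e) 1 (u - v) +
          2 * (1 / 2 + 1 / Cinv) * H⁻¹ * M.h ^ 2 * semiSq (M.elem e) 1 (p - q)) := by
          refine Finset.sum_le_sum fun e _ => ?_
          rw [mul_add, ← mul_assoc (τM e) (2 * ‖a‖ ^ 2), ← mul_assoc (τM e) 2 (semiSq _ _ _)]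
          exact add_le_add (mul_le_mul_of_nonneg_right (t1 e) (semiSqVec_nonneg _ _ _))
            (mul_le_mul_of_nonneg_right (t2 e) (semiSq_nonneg _ _ _))
      _ = H * ∑ e, semiSqVec (M.elem e) 1 (u - v) + 2 * (1 / 2 + 1 / Cinv) *
          (H⁻¹ * (M.h ^ 2 * ∑ e, semiSq (M.elem e) 1 (p - q))) := by
          rw [Finset.sum_add_distrib, ← Finset.mul_sum, ← Finset.mul_sum]
          ring
      _ ≤ _ := by gcongr
  have eV : stabPairing M τM (viscField M ν (u - v)) (viscField M ν (u - v)) ≤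
      4 * d / Cinv * (H * X) := by
    refine (stabPairing_viscField_le hτ0 hηe ν).trans ?_
    calc ∑ e, τM e * (4 * ν ^ 2 * d * semiSqVec (M.elem e) 2 (u - v))
        ≤ ∑ e, 4 * d / Cinv * H * M.h ^ 2 * semiSqVec (M.elem e) 2 (u - v) := by
          refine Finset.sum_le_sum fun e _ => ?_
          rw [← mul_assoc]
          exact mul_le_mul_of_nonneg_right (t3 e) (semiSqVec_nonneg _ _ _)
      _ = 4 * d / Cinv * (H * (M.h ^ 2 * ∑ e, semiSqVec (M.elem e) 2 (u - v))) := by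
          rw [← Finset.mul_sum]
          ring
      _ ≤ _ := by gcongr
  -- the discrete error
  have hid := error_identity (τM := τM) hdiv hF hsol hu hp hred hv hq
  -- Together `b1` to `b5` put at most `3/4` of the viscous part and `7/8` of the stabilized part of
  -- the discrete error on the right: `1/4 + 1/4 + 1/4` and `1/2 + 1/8 + 1/8 + 1/8`.
  have b1 := (le_abs_self _).trans (abs_stabPairing_le hτ0
    (ElemL2.viscField (M := M) (ν := ν) (S.Vh_regular _ hwmem.1)) hB one_half_pos)
  have b1' := stabPairing_viscField_le_formK hν hCinv hinv hh hτd hwmem.1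
  have b2 := (neg_le_abs _).trans (abs_formC_le_of_interpolation hstab hf_mono hf_pos hh ha hν hpos
    hκ hhq hηdiv hw hr hX h0)
  have b3 := (neg_le_abs _).trans (abs_formK_le hΩ hν.le hη hw)
  have b4 := (neg_le_abs _).trans (abs_stabPairing_le hτ0
    (ElemL2.convField (M := M) (a := a) hη hψ) hB two_pos)
  have b5 := (le_abs_self _).trans (abs_stabPairing_le hτ0
    (ElemL2.viscField (M := M) (ν := ν) hηe) hB two_pos)
  have htri := tripleNormSq_sub_le (M := M) (a := a) hν.le hτ0 hu1 hv1 huh1 hp hq1 hpt1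
  simp only [tripleNormSq_eq] at htri ⊢
  have n1 := formK_self_nonneg hν.le Ω (u - v)
  have n2 := stabPairing_self_nonneg (M := M) hτ0 (convField n Ω a (u - v) (p - q))
  have n3 := stabPairing_self_nonneg (M := M) hτ0 (viscField M ν (u - v))
  have n4 := formK_self_nonneg hν.le Ω (v - uh)
  have n5 := stabPairing_self_nonneg (M := M) hτ0 (convField n Ω a (v - uh) (q - pt))
  rw [← hH] at b2
  have hHX : 0 ≤ H * X := by positivity
  have hHY : 0 ≤ H⁻¹ * Y := by positivity
  have hc1 : 0 ≤ 4 * κ / f (1 / (2 * κ)) * (H * X) := by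
    have := hf_pos (1 / (2 * κ)) (by positivity)
    positivity
  have hc2 : 0 ≤ 4 * d / Cinv * (H * X) := by positivity
  have hc3 : 0 ≤ (1 / 2 + 1 / Cinv) * (H⁻¹ * Y) := by positivity
  have e8 : 8 * d / Cinv * (H * X) = 2 * (4 * d / Cinv * (H * X)) := by ring
  norm_num at b1 b4 b5
  -- Absorption costs a factor `8` and the triangle inequality a factor `2`. With the interpolation
  -- error itself this gives `16 + 2 = 18` on its viscous part; the remaining numerical constants
  -- leave room for the other terms.
  linarith

end Rates

end Oseen

/-! ### The main theorem: inserting the interpolants -/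

theorem mainTheorem2 (d : ℕ) (Cinv Cinterp Cqu : ℝ) (hCinv : 0 < Cinv) (f : ℝ → ℝ)
    (hf_mono : MonotoneOn f (Set.Ioi 0)) (hf_pos : ∀ γ > 0, 0 < f γ)
    (hf_le : ∀ γ > 0, f γ ≤ min 1 (4 * γ / Cinv)) :
    ∃ Cbound > (0 : ℝ),
      ∀ (Ω : Set (Oseen.E d)), Ω.Nonempty → Bornology.IsBounded Ω →
      ∀ (n : ℕ) (M : Oseen.Mesh Ω n), M.QuasiUniform Cqu →
      ∀ (S : Oseen.DiscreteSpaces M) (a : Oseen.E d) (ν : ℝ), a ≠ 0 → 0 < ν →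
      ∀ (τC : Oseen.E d → ℝ) (τM : Fin n → ℝ) (kv kq : ℕ), (∀ x, 0 ≤ τC x) → 1 ≤ kv →
      S.InverseEstimate ν Cinv →
      S.DivConforming →
      S.InterpolationEstimates kv kq Cinterp →
      Oseen.StabilizationParameter M a ν f τM →
      ∀ (F : Oseen.E d → Oseen.E d), MemLp F 2 (volume.restrict Ω) →
      ∀ (u : Oseen.E d → Oseen.E d) (p : Oseen.E d → ℝ), Oseen.IsOseenSolution Ω a ν F u p →
      Oseen.MemHVec Ω (kv + 1) u → Oseen.MemH Ω (kq + 1) p →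
      ∀ (uh : Oseen.E d → Oseen.E d) (pt : Oseen.E d → ℝ),
      Oseen.IsReducedSolution S a ν τC τM F uh pt →
      Oseen.tripleNormSq M a ν τM (u - uh) (p - pt) ≤
        Cbound * (max (‖a‖ * M.h) ν * M.h ^ (2 * kv) * Oseen.semiSqVec Ω (kv + 1) u +
          (max (‖a‖ * M.h) ν)⁻¹ * M.h ^ (2 * kq + 2) * Oseen.semiSq Ω (kq + 1) p) := by
  -- `Cqu` and `Cinterp` are arbitrary reals; enlarging them to `max Cqu 1` and `|Cinterp| + 1`
  -- provides positive constants.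
  set κ := max Cqu 1 with hκdef
  have hκ : 0 < κ := one_pos.trans_le (le_max_right _ _)
  have hm : 0 < f (1 / (2 * κ)) := hf_pos _ (by positivity)
  set c₁ := 4 * κ / f (1 / (2 * κ)) + 6 + 8 * d / Cinv with hc₁
  set c₂ := 4 * (1 / 2 + 1 / Cinv) with hc₂
  have hc₁pos : 0 < c₁ := by positivity
  have hc₂pos : 0 < c₂ := by positivity
  refine ⟨18 * ((c₁ + c₂) * (|Cinterp| + 1)), by positivity, ?_⟩
  intro Ω hne hbd n M hqu S a ν ha hν τC τM kv kq _ hkv hinv hdiv hint hstab F hF u p hsol hu hp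
    uh pt hred
  have hh := M.he_pos hbd ha
  have hpos : 0 < M.h := by
    obtain ⟨e⟩ := M.nonempty_index hne
    exact (hh e).trans_le (M.he_le_h e)
  have hqu' : M.QuasiUniform κ := fun e e' =>
    (hqu e e').trans (mul_le_mul_of_nonneg_right (le_max_left _ _) (hh e').le)
  obtain ⟨Iv, Iq, hIv, hIq, hIv', hIq'⟩ := hint
  have hudiv := hsol.mem_VDivFree M.isOpen hbd
  obtain ⟨-, hv⟩ := hIv' u hudiv hu
  obtain ⟨-, hq⟩ := hIq' p hsol.2.1 hp
  set su := Oseen.semiSqVec Ω (kv + 1) u with hsu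
  set sp := Oseen.semiSq Ω (kq + 1) p with hsp
  have hsu0 : 0 ≤ su := Oseen.semiSqVec_nonneg _ _ _
  have hsp0 : 0 ≤ sp := Oseen.semiSq_nonneg _ _ _
  set C := |Cinterp| + 1 with hC
  have hC0 : 0 < C := by positivity
  have hCle : Cinterp ≤ C := (le_abs_self _).trans (by linarith)
  -- Since `1 ≤ kv`, the order `l = 2` is admissible; the substitution removes the truncated
  -- subtraction from its exponent.
  obtain ⟨k, rfl⟩ : ∃ k, kv = k + 1 := ⟨kv - 1, by omega⟩
  have mono : ∀ {s : ℝ} (m : ℕ), 0 ≤ s → Cinterp * M.h ^ m * s ≤ C * M.h ^ m * s :=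
    fun m hs => by gcongr
  have h0 := (hv 0 (by omega)).trans (mono _ hsu0)
  have h1 := (hv 1 (by omega)).trans (mono _ hsu0)
  have h2 := (hv 2 (by omega)).trans (mono _ hsu0)
  have h3 := (hq 1 (by omega)).trans (mono _ hsp0)
  -- `X` and `Y` carry the common rates: the estimates of order `0`, `1`, `2` for the velocity
  -- differ exactly by the powers of `h` in the hypotheses of the lemma.
  have key := Oseen.tripleNormSq_error_le (X := C * M.h ^ (2 * (k + 1)) * su)
    (Y := C * M.h ^ (2 * kq + 2) * sp) hbd hne hCinv hf_mono hf_pos hf_le hκ hqu' ha hν hinv hdiv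
    hstab hF hsol (Oseen.MemHVec.of_le hu (by omega)) (hp.of_le (by omega)) hred (hIv u hudiv)
    (hIq p hsol.2.1) (by positivity) (by positivity)
    (h0.trans (le_of_eq (by rw [Nat.sub_zero]; ring)))
    (h1.trans (le_of_eq (by rw [Nat.add_sub_cancel])))
    ((mul_le_mul_of_nonneg_left h2 (by positivity)).trans
      (le_of_eq (by rw [show k + 1 + 1 - 2 = k by omega]; ring)))
    ((mul_le_mul_of_nonneg_left h3 (by positivity)).trans
      (le_of_eq (by rw [Nat.add_sub_cancel]; ring)))
  refine key.trans ?_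
  rw [← hc₁, ← hc₂]
  set H := max (‖a‖ * M.h) ν with hH
  have hHpos : 0 < H := hν.trans_le (le_max_right _ _)
  have p1 : 0 ≤ H * M.h ^ (2 * (k + 1)) * su := by positivity
  have p2 : 0 ≤ H⁻¹ * M.h ^ (2 * kq + 2) * sp := by positivity
  calc _ = 18 * (C * (c₁ * (H * M.h ^ (2 * (k + 1)) * su) +
        c₂ * (H⁻¹ * M.h ^ (2 * kq + 2) * sp))) := by ring
    _ ≤ 18 * (C * ((c₁ + c₂) * (H * M.h ^ (2 * (k + 1)) * su) +
        (c₁ + c₂) * (H⁻¹ * M.h ^ (2 * kq + 2) * sp))) := by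
        gcongr <;> linarith
    _ = _ := by ring
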